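/- Let $\pi=(\pi_1,\dots,\pi_n)$ and $\sigma=(\sigma_1,\dots,\sigma_m)$ ($n,m\ge 1$) be separated curves in $\mathbb{R}$, i.e. $\pi_i\ge 0\ge\sigma_j$ for all $i,j$, and let $\delta>0$. The discrete Fréchet distance is $d_{\mathrm{dF}}(\pi,\sigma)=\inf_{\phi_1,\phi_2}\max_{t\in[0,1]}|\pi_{\phi_1(t)}-\sigma_{\phi_2(t)}|$, over all non-decreasing functions $\phi_1$ from $[0,1]$ onto $\{1,\dots,n\}$ and $\phi_2$ from $[0,1]$ onto $\{1,\dots,m\}$. For indices $i,j$ let $\mathrm{vis}_\sigma(i,j)=\{k\ge j:\sigma_k\ge\pi_i-\delta\}$ and $\mathrm{vis}_\pi(i,j)=\{k\ge i:\pi_k\le\sigma_j+\delta\}$. Let $\mathrm{reach}_\sigma(i,j)$ be the longest contiguous index sequence $j+1,\dots,j+k$ contained in $\mathrm{vis}_\sigma(i,j)$, and let $\mathrm{reach}_\pi(i,j)$ be the longest contiguous index sequence $i+1,\dots,i+k$ contained in $\mathrm{vis}_\pi(i,j)$. An index $p'\in\mathrm{reach}_\pi(p,q)$ is a greedy step on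 $\pi$ from $(p,q)$ if $\mathrm{vis}_\sigma(i,q)\subseteq\mathrm{vis}_\sigma(p',q)$ for all $p\le i\le p'$. An index $q'\in\mathrm{reach}_\sigma(p,q)$ is a greedy step on $\sigma$ from $(p,q)$ if $\mathrm{vis}_\pi(p,i)\subseteq\mathrm{vis}_\pi(p,q')$ for all $q\le i\le q'$. The greedy algorithm works as follows. If $|\pi_1-\sigma_1|>\delta$, answer "$d_{\mathrm{dF}}(\pi,\sigma)>\delta$". Otherwise set $p=q=1$ and repeat the following iteration: if there is a greedy step on $\pi$ from $(p,q)$, replace $p$ by an arbitrary such step; then, if there is a greedy step on $\sigma$ from the current $(p,q)$, replace $q$ by an arbitrary such step. Stop after an iteration that finds no greedy step. Answer "$d_{\mathrm{dF}}(\pi,\sigma)\le\delta$" if $p=n$ and $q=m$, and "$d_{\mathrm{dF}}(\pi,\sigma)>\delta$" otherwise. Then: 1. For every choice of the greedy steps, the algorithm terminates (fewer than $n+m$ iterations find a greedy step) and its answer is correct. 2. The algorithm can be implemented to run in time $\mathcal{O}((n+m)\log(nm+1))$ on a real RAM: there are an absolute constant $C$ and a single program which, on every such input $(\pi,\sigma,\delta)$,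 carries out an execution of the greedy algorithm (it outputs the pairs $(p,q)$ visited, followed by the answer) and halts after at most $C\,(n+m)\log(nm+1)$ elementary operations. Elementary operations, each of unit cost, are addition, subtraction (truncated at $0$ for natural numbers), comparison, and array access, on natural numbers and on real numbers. -/

import Mathlib

namespace GreedyFrechet

/-! ### Discrete Fréchet distance -/

/-- The discrete traversals of one curve with `n` vertices: the non-decreasing functions from
`[0,1]` onto the index set. Indices are 0-based, so `Fin n` stands for `[1..n]`. -/
def Traversal (n : ℕ) : Type :=
  {φ : unitInterval → Fin n // Monotone φ ∧ Function.Surjective φ}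

/-- The width `max_t dist (π_{φ₁(t)}, σ_{φ₂(t)})` of a pair of traversals. -/
noncomputable def width {X : Type*} [PseudoMetricSpace X] {n m : ℕ} (π : Fin n → X)
    (σ : Fin m → X) (φ : Traversal n × Traversal m) : ℝ :=
  ⨆ t : unitInterval, dist (π (φ.1.1 t)) (σ (φ.2.1 t))

/-- The discrete Fréchet distance of two curves with vertex sequences `π` and `σ`. -/
noncomputable def discreteFrechet {X : Type*} [PseudoMetricSpace X] {n m : ℕ} (π : Fin n → X)
    (σ : Fin m → X) : ℝ :=
  ⨅ φ : Traversal n × Traversal m, width π σ φ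

/-! ### Visibility, reachability, greedy steps -/

/-- One-dimensional separated curves: `π_i ≥ 0 ≥ σ_j`. -/
def Separated {n m : ℕ} (π : Fin n → ℝ) (σ : Fin m → ℝ) : Prop :=
  (∀ i, 0 ≤ π i) ∧ ∀ j, σ j ≤ 0

section Algorithm

variable {n m : ℕ} (π : Fin n → ℝ) (σ : Fin m → ℝ) (δ : ℝ)

/-- `vis_σ(i,j)`: the vertices of `σ` from `σ_j` on that are seen by `π_i`. -/
def visSigma (i : Fin n) (j : Fin m) : Set (Fin m) := {k | j ≤ k ∧ π i - δ ≤ σ k}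

/-- `vis_π(i,j)`: the vertices of `π` from `π_i` on that are seen by `σ_j`. -/
def visPi (i : Fin n) (j : Fin m) : Set (Fin n) := {k | i ≤ k ∧ π k ≤ σ j + δ}

/-- `reach_σ(i,j)`: the longest contiguous sequence `[j+1..j+k]` contained in `vis_σ(i,j)`. -/
def reachSigma (i : Fin n) (j : Fin m) : Set (Fin m) :=
  {k | j < k ∧ Set.Ioc j k ⊆ visSigma π σ δ i j}

/-- `reach_π(i,j)`: the longest contiguous sequence `[i+1..i+k]` contained in `vis_π(i,j)`. -/
def reachPi (i : Fin n) (j : Fin m) : Set (Fin n) :=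
  {k | i < k ∧ Set.Ioc i k ⊆ visPi π σ δ i j}

/-- `p'` is a greedy step on `π` from `(p,q)`. -/
def IsGreedyStepPi (p : Fin n) (q : Fin m) (p' : Fin n) : Prop :=
  p' ∈ reachPi π σ δ p q ∧
    ∀ i, p ≤ i → i ≤ p' → visSigma π σ δ i q ⊆ visSigma π σ δ p' q

/-- `q'` is a greedy step on `σ` from `(p,q)`. -/
def IsGreedyStepSigma (p : Fin n) (q : Fin m) (q' : Fin m) : Prop :=
  q' ∈ reachSigma π σ δ p q ∧
    ∀ i, q ≤ i → i ≤ q' → visPi π σ δ p i ⊆ visPi π σ δ p q'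

/-! ### The greedy algorithm -/

/-- `if p' ← GreedyStep_π(p,q) then p ← p'`, for an arbitrary choice of the greedy step; the
second disjunct is the case that `GreedyStep_π` reports an error. -/
def UpdatePi (p : Fin n) (q : Fin m) (p' : Fin n) : Prop :=
  IsGreedyStepPi π σ δ p q p' ∨ (p' = p ∧ ∀ r, ¬ IsGreedyStepPi π σ δ p q r)

/-- `if q' ← GreedyStep_σ(p,q) then q ← q'`, for an arbitrary choice of the greedy step. -/
def UpdateSigma (p : Fin n) (q : Fin m) (q' : Fin m) : Prop :=
  IsGreedyStepSigma π σ δ p q q' ∨ (q' = q ∧ ∀ r, ¬ IsGreedyStepSigma π σ δ p q r)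

/-- One iteration of the loop, from the pair `x` to the pair `y`: first an update on `π`, then
one on `σ` with the new index on `π`. -/
def Iteration (x y : Fin n × Fin m) : Prop :=
  UpdatePi π σ δ x.1 x.2 y.1 ∧ UpdateSigma π σ δ y.1 x.2 y.2

/-- An iteration after which the loop continues, i.e. one that found a greedy step (greedy steps
strictly increase an index, so this means that the pair changed). -/
def LoopStep (x y : Fin n × Fin m) : Prop := Iteration π σ δ x y ∧ y ≠ x

/-- The loop ends at the pair `x`: an iteration from `x` finds no greedy step. -/
def LoopEnds (x : Fin n × Fin m) : Prop :=
  (∀ r, ¬ IsGreedyStepPi π σ δ x.1 x.2 r) ∧ ∀ r, ¬ IsGreedyStepSigma π σ δ x.1 x.2 r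

/-- `L` lists the pairs `(p,q)` of a (possibly unfinished) run of the loop from the first
pair of indices, in order. -/
def IsPartialRun [NeZero n] [NeZero m] (L : List (Fin n × Fin m)) : Prop :=
  L.head? = some (0, 0) ∧ L.IsChain (LoopStep π σ δ)

/-- The greedy algorithm has an execution that goes through the pairs in `L` and
returns the answer `b` (`true` stands for "distance at most `δ`").
The algorithm first tests whether the two initial vertices are within distance `δ`; if not, it
answers `false`. Otherwise it runs the loop until no greedy step is found, and answers `true` iff
the last pair consists of the last indices of both curves. -/
def GreedyExecution [NeZero n] [NeZero m] (L : List (Fin n × Fin m)) (b : Bool) : Prop :=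
  (δ < dist (π 0) (σ 0) ∧ L = [] ∧ b = false) ∨
  (dist (π 0) (σ 0) ≤ δ ∧ IsPartialRun π σ δ L ∧
    ∃ x : Fin n × Fin m, L.getLast? = some x ∧ LoopEnds π σ δ x ∧
      (b = true ↔ (x.1 : ℕ) + 1 = n ∧ (x.2 : ℕ) + 1 = m))

end Algorithm

/-! ### A real random access machine with unit costs

A memory of natural numbers, with addition, truncated subtraction and comparison, and a memory of
real numbers, with addition, subtraction and comparison. Both consist of variables and of arrays
that are addressed by natural numbers. There is no rounding, no multiplication and no real
constant. Programs are finite `while` programs over finitely many variables and arrays. -/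

/-- A memory configuration, with a write-only output sequence. -/
structure State where
  ivar : ℕ → ℕ
  rvar : ℕ → ℝ
  iarr : ℕ → ℕ → ℕ
  rarr : ℕ → ℕ → ℝ
  out : List ℕ

/-- Integer expressions: constants, variables, array cells, sums and truncated differences. -/
inductive IExp where
  | lit (k : ℕ)
  | var (x : ℕ)
  | cell (a : ℕ) (i : IExp)
  | add (e f : IExp)
  | sub (e f : IExp)

/-- Real expressions: variables, array cells, sums and differences. -/
inductive RExp where
  | var (x : ℕ)
  | cell (a : ℕ) (i : IExp)
  | add (e f : RExp)
  | sub (e f : RExp)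

/-- Tests. -/
inductive Test where
  | ile (e f : IExp)
  | rle (e f : RExp)
  | neg (c : Test)
  | and (c d : Test)

def IExp.eval (s : State) : IExp → ℕ
  | .lit k => k
  | .var x => s.ivar x
  | .cell a i => s.iarr a (i.eval s)
  | .add e f => e.eval s + f.eval s
  | .sub e f => e.eval s - f.eval s

noncomputable def RExp.eval (s : State) : RExp → ℝ
  | .var x => s.rvar x
  | .cell a i => s.rarr a (i.eval s)
  | .add e f => e.eval s + f.eval s
  | .sub e f => e.eval s - f.eval s

def Test.holds (s : State) : Test → Prop
  | .ile e f => e.eval s ≤ f.eval s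
  | .rle e f => e.eval s ≤ f.eval s
  | .neg c => ¬ c.holds s
  | .and c d => c.holds s ∧ d.holds s

/-- The number of elementary operations in an expression. -/
def IExp.cost : IExp → ℕ
  | .lit _ => 1
  | .var _ => 1
  | .cell _ i => i.cost + 1
  | .add e f => e.cost + f.cost + 1
  | .sub e f => e.cost + f.cost + 1

def RExp.cost : RExp → ℕ
  | .var _ => 1
  | .cell _ i => i.cost + 1
  | .add e f => e.cost + f.cost + 1
  | .sub e f => e.cost + f.cost + 1

def Test.cost : Test → ℕ
  | .ile e f => e.cost + f.cost + 1
  | .rle e f => e.cost + f.cost + 1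
  | .neg c => c.cost + 1
  | .and c d => c.cost + d.cost + 1

/-- Programs: assignments, output of a number, composition, `if c then P else Q`,
`while c do P`. -/
inductive Prog where
  | setI (x : ℕ) (e : IExp)
  | setR (x : ℕ) (e : RExp)
  | storeI (a : ℕ) (i : IExp) (e : IExp)
  | storeR (a : ℕ) (i : IExp) (e : RExp)
  | emit (e : IExp)
  | seq (P Q : Prog)
  | branch (c : Test) (P Q : Prog)
  | loop (c : Test) (P : Prog)

/-- Overwrite the cell with index `i` of the array `a` by `v`. -/
def setCell {α : Type} (A : ℕ → ℕ → α) (a i : ℕ) (v : α) : ℕ → ℕ → α :=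
  Function.update A a (Function.update (A a) i v)

/-- `Exec P s t s'`: started in `s`, the program `P` halts after `t` elementary operations in the
configuration `s'`. -/
inductive Exec : Prog → State → ℕ → State → Prop
  | setI (x : ℕ) (e : IExp) (s : State) :
      Exec (.setI x e) s (e.cost + 1)
        { s with ivar := Function.update s.ivar x (e.eval s) }
  | setR (x : ℕ) (e : RExp) (s : State) :
      Exec (.setR x e) s (e.cost + 1)
        { s with rvar := Function.update s.rvar x (e.eval s) }
  | storeI (a : ℕ) (i e : IExp) (s : State) :
      Exec (.storeI a i e) s (i.cost + e.cost + 1)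
        { s with iarr := setCell s.iarr a (i.eval s) (e.eval s) }
  | storeR (a : ℕ) (i : IExp) (e : RExp) (s : State) :
      Exec (.storeR a i e) s (i.cost + e.cost + 1)
        { s with rarr := setCell s.rarr a (i.eval s) (e.eval s) }
  | emit (e : IExp) (s : State) :
      Exec (.emit e) s (e.cost + 1) { s with out := s.out ++ [e.eval s] }
  | seq {P Q : Prog} {s s' s'' : State} {t t' : ℕ} :
      Exec P s t s' → Exec Q s' t' s'' → Exec (.seq P Q) s (t + t') s''
  | branchTrue {c : Test} {P Q : Prog} {s s' : State} {t : ℕ} :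
      c.holds s → Exec P s t s' → Exec (.branch c P Q) s (c.cost + 1 + t) s'
  | branchFalse {c : Test} {P Q : Prog} {s s' : State} {t : ℕ} :
      ¬ c.holds s → Exec Q s t s' → Exec (.branch c P Q) s (c.cost + 1 + t) s'
  | loopEnd {c : Test} {P : Prog} {s : State} :
      ¬ c.holds s → Exec (.loop c P) s (c.cost + 1) s
  | loopStep {c : Test} {P : Prog} {s s' s'' : State} {t t' : ℕ} :
      c.holds s → Exec P s t s' → Exec (.loop c P) s' t' s'' →
        Exec (.loop c P) s (c.cost + 1 + t + t') s''

/-- The initial configuration: `n`, `m` in the integer variables 0 and 1, `δ` in the real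
variable 0, the curves `π`, `σ` in the real arrays 0 and 1, and zeros elsewhere. -/
noncomputable def inputState {n m : ℕ} (π : Fin n → ℝ) (σ : Fin m → ℝ) (δ : ℝ) : State where
  ivar x := if x = 0 then n else if x = 1 then m else 0
  rvar x := if x = 0 then δ else 0
  iarr _ _ := 0
  rarr a i :=
    if a = 0 then (if h : i < n then π ⟨i, h⟩ else 0)
    else if a = 1 then (if h : i < m then σ ⟨i, h⟩ else 0)
    else 0
  out := []

/-- The protocol of an execution of the greedy algorithm: the indices `p`, `q` of all pairs in
order, followed by the answer (1 for `true`, 0 for `false`). -/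
def protocol {n m : ℕ} (L : List (Fin n × Fin m)) (b : Bool) : List ℕ :=
  L.flatMap (fun x => [(x.1 : ℕ), (x.2 : ℕ)]) ++ [b.toNat]

end GreedyFrechet

open GreedyFrechet

/-!
The algorithm is analysed through the free pairs `(i,j)`, those with `π_i - σ_j ≤ δ`; the curves
being separated, these are the pairs at distance at most `δ`.

*Correctness.* A greedy step moves through free pairs, so a run that ends at the last pair yields
a pair of traversals of width at most `δ` (`FreelyReachable`, `exists_traversal_of_seq`).
Conversely, let a pair of traversals of width at most `δ` be given, and raise its coordinates to
at least the current pair `(p,q)`. The raised path stays free throughout the run, because the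
target of a greedy step sees whatever the vertices passed over see (`GreedyStep.free_max`). When no
greedy step is left, all later reachable vertices see less than the current one
(`exists_unseen_of_no_step`), and this forbids a free path to leave the rectangle of reachable
indices (`forall_free_of_stuck`) and also to end inside it, except at `(p,q)` itself
(`eq_last_of_stuck`).

*Running time.* Sort the numbers `-σ_j` and `δ - π_i` together, the former first in case of ties.
The pair `(i,j)` is free iff `-σ_j` precedes `δ - π_i`, so that with ranks one obtains natural
numbers `h i`, `g j` and `D` such that `(i,j)` is free iff `h i + g j ≤ D`. A greedy step on `π` from
`(p,q)` is found by three searches for the first entry above a threshold in an array of natural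
numbers: for the largest `g k ≤ D - h p` with `k ≥ q`, which is found in the inverse of the ranking;
for the first `i > p` that sees a vertex of this height; and for the first `i > p` that is not seen
from `q`. There is a greedy step iff `i` is found before the last one, and then `i` is
a greedy step (`greedyStep_of_lt`, `not_greedyStep_of_le`). Each search takes logarithmic time by
a table of maxima over intervals whose lengths are powers of two (`runs_findProg`). The table and the
order are computed in time `O((n + m) log (n + m))` (`runs_tableProg`, `runs_sortProg`), and every
iteration but the last increases `p + q`.

Programs are verified with the predicate `Runs P s T Q`, total correctness within time `T`: programs
without loops are evaluated by `Prog.run`, loops are handled by `Runs.loop` and `Runs.count`, and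
what a program leaves unchanged is read off its text (`Exec.sameExcept`).
The integer variables are used as follows: 0 and 1 hold `n` and `m`; 2 and 3 hold `p` and `q`; 4 tells
whether a greedy step has been found; 5 holds `n + m`, 6 holds `D`, 8 and 9 hold the length and the
number of levels of the table that are searched; 30 to 35 hold the beginnings of its sections; 10 to 16 and 20 to 25
are auxiliary. The integer arrays are: 0 for sorting, 1 for the table, 2 and 3 for the widths and
offsets of its levels; the real array 2 holds the keys for sorting.
-/

namespace GreedyFrechet

/-! ### Correctness of the greedy algorithm -/

/-- A greedy step on the first of two curves from `(p,q)`, for an arbitrary relation `F` in place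
of "`i` and `j` are within distance `δ`". -/
def GreedyStep {ι κ : Type*} [LinearOrder ι] [LinearOrder κ] (F : ι → κ → Prop)
    (p : ι) (q : κ) (p' : ι) : Prop :=
  p < p' ∧ (∀ i, p < i → i ≤ p' → F i q) ∧
    ∀ i, p ≤ i → i ≤ p' → ∀ k, q ≤ k → F i k → F p' k

section Translation

variable {n m : ℕ} {π : Fin n → ℝ} {σ : Fin m → ℝ} {δ : ℝ}

theorem isGreedyStepPi_iff {p p' : Fin n} {q : Fin m} :
    IsGreedyStepPi π σ δ p q p' ↔ GreedyStep (fun i j => π i - σ j ≤ δ) p q p' := by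
  unfold IsGreedyStepPi GreedyStep reachPi visPi visSigma
  simp only [Set.mem_ofPred_eq, Set.subset_def, Set.mem_Ioc, and_assoc, and_imp]
  refine and_congr_right fun hp => and_congr ?_ ?_
  · refine forall_congr' fun i => forall_congr' fun h1 => forall_congr' fun h2 => ?_
    constructor
    · rintro ⟨_, h⟩; linarith
    · intro h; exact ⟨h1.le, by linarith⟩
  · refine forall_congr' fun i => forall_congr' fun h1 => forall_congr' fun h2 =>
      forall_congr' fun k => forall_congr' fun hk => ?_
    constructor
    · intro h h'; have := (h (by linarith)).2; linarith
    · intro h h'; exact ⟨hk, by have := h (by linarith); linarith⟩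

theorem isGreedyStepSigma_iff {p : Fin n} {q q' : Fin m} :
    IsGreedyStepSigma π σ δ p q q' ↔ GreedyStep (fun j i => π i - σ j ≤ δ) q p q' := by
  unfold IsGreedyStepSigma GreedyStep reachSigma visPi visSigma
  simp only [Set.mem_ofPred_eq, Set.subset_def, Set.mem_Ioc, and_assoc, and_imp]
  refine and_congr_right fun hp => and_congr ?_ ?_
  · refine forall_congr' fun i => forall_congr' fun h1 => forall_congr' fun h2 => ?_
    constructor
    · rintro ⟨_, h⟩; linarith
    · intro h; exact ⟨h1.le, by linarith⟩
  · refine forall_congr' fun i => forall_congr' fun h1 => forall_congr' fun h2 =>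
      forall_congr' fun k => forall_congr' fun hk => ?_
    constructor
    · intro h h'; have := (h (by linarith)).2; linarith
    · intro h h'; exact ⟨hk, by have := h (by linarith); linarith⟩

theorem Separated.dist_le_iff (h : Separated π σ) (i : Fin n) (j : Fin m) :
    dist (π i) (σ j) ≤ δ ↔ π i - σ j ≤ δ := by
  rw [Real.dist_eq, abs_of_nonneg]
  linarith [h.1 i, h.2 j]

end Translation

section Stuck

variable {ι κ : Type*} [LinearOrder ι] [LinearOrder κ] {a : ι → ℝ} {b : κ → ℝ} {δ : ℝ}
  {p : ι} {q : κ}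

/-- Without a greedy step, every reachable index sees strictly less than the current one. -/
theorem exists_unseen_of_no_step [Finite ι]
    (hno : ∀ r, ¬ GreedyStep (fun i j => a i + b j ≤ δ) p q r)
    {p' : ι} (hp : p < p') (hreach : ∀ i, p < i → i ≤ p' → a i + b q ≤ δ) :
    ∃ k, q ≤ k ∧ a p + b k ≤ δ ∧ δ < a p' + b k := by
  by_contra! hcon
  obtain ⟨r, ⟨hr1, hr2⟩, hr⟩ := Set.exists_min_image (Set.Ioc p p') a (Set.toFinite _)
    ⟨p', hp, le_rfl⟩
  refine hno r ⟨hr1, fun i h1 h2 => hreach i h1 (h2.trans hr2), fun i h1 h2 k hk hik => ?_⟩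
  rcases h1.eq_or_lt with rfl | h1
  · linarith [hcon k hk hik, hr p' ⟨hp, le_rfl⟩]
  · linarith [hr i ⟨h1, h2.trans hr2⟩]

variable {T : Type*} [LinearOrder T] {α : T → ι} {β : T → κ}

/-- If no greedy step exists, a monotone path through the free cells cannot leave the rectangle
spanned by the reachable indices. -/
theorem forall_free_of_stuck [Finite ι] [Finite κ] (hα : Monotone α) (hβ : Monotone β)
    (hα' : ∀ i, p ≤ i → ∃ t, α t = i) (hβ' : ∀ j, q ≤ j → ∃ t, β t = j)
    (hβq : ∀ t, q ≤ β t) (hαp : ∀ t, p ≤ α t)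
    (hfree : ∀ t, a (α t) + b (β t) ≤ δ) (hpq : a p + b q ≤ δ)
    (hno : ∀ r, ¬ GreedyStep (fun i j => a i + b j ≤ δ) p q r)
    (hno' : ∀ r, ¬ GreedyStep (fun j i => b j + a i ≤ δ) q p r) :
    ∀ i, p < i → a i + b q ≤ δ := by
  by_contra! hex
  obtain ⟨e, ⟨he1, he2⟩, hemin⟩ := Set.exists_min_image {i | p < i ∧ δ < a i + b q} id
    (Set.toFinite _) hex
  have hreach : ∀ i, p < i → i < e → a i + b q ≤ δ := fun i h1 h2 => by
    by_contra! h
    exact absurd (hemin i ⟨h1, h⟩) (not_le.2 h2)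
  obtain ⟨t, ht⟩ := hα' e he1.le
  have hft := hfree t
  rw [ht] at hft
  have hq : q < β t := by
    rcases (hβq t).eq_or_lt with h | h
    · rw [← h] at hft; linarith
    · exact h
  have hex' : ∃ j, q < j ∧ j ≤ β t ∧ δ < a p + b j := by
    by_contra! hcon
    obtain ⟨k, hk, h1, h2⟩ := exists_unseen_of_no_step hno' hq
      (fun j h1 h2 => by linarith [hcon j h1 h2])
    linarith
  obtain ⟨e', ⟨hf1, hf3, hf2⟩, hfmin⟩ := Set.exists_min_image
    {j | q < j ∧ j ≤ β t ∧ δ < a p + b j} id (Set.toFinite _) hex'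
  have hreach' : ∀ j, q < j → j < e' → a p + b j ≤ δ := fun j h1 h2 => by
    by_contra! h
    exact absurd (hfmin j ⟨h1, h2.le.trans hf3, h⟩) (not_le.2 h2)
  obtain ⟨t', ht'⟩ := hβ' e' hf1.le
  have hft' := hfree t'
  rw [ht'] at hft'
  -- The path passes through the corner `(e, e')`.
  have hcorner : a e + b e' ≤ δ := by
    rcases le_total t t' with h | h
    · have := hβ h
      rw [ht'] at this
      rwa [le_antisymm this hf3] at hft
    · have hle := hα h
      rw [ht] at hle
      rcases hle.eq_or_lt with h' | h'
      · rwa [h'] at hft'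
      · have hp : p < α t' := by
          rcases (hαp t').eq_or_lt with h'' | h''
          · rw [← h''] at hft'; linarith
          · exact h''
        obtain ⟨k, hk, h1, h2⟩ := exists_unseen_of_no_step hno hp
          (fun i h1 h2 => hreach i h1 (h2.trans_lt h'))
        linarith
  linarith

/-- If no greedy step exists and the current index on the first curve is not the last one, then
some later vertex of the second curve can be seen from no later vertex of the first curve. -/
theorem exists_blocking [Finite ι] {N : ι} (hp : p < N)
    (hno : ∀ r, ¬ GreedyStep (fun i j => a i + b j ≤ δ) p q r)
    (h : ∀ i, p < i → a i + b q ≤ δ) :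
    ∃ k, q < k ∧ ∀ i, p < i → δ < a i + b k := by
  -- A minimal later vertex of the first curve sees most.
  obtain ⟨r, hr1, hr⟩ := Set.exists_min_image (Set.Ioi p) a (Set.toFinite _) ⟨N, hp⟩
  obtain ⟨k, hk, -, hk2⟩ := exists_unseen_of_no_step hno hr1 fun i h1 _ => h i h1
  refine ⟨k, hk.lt_of_ne ?_, fun i hi => ?_⟩
  · rintro rfl
    linarith [h r hr1]
  · linarith [hr i hi]

/-- A monotone path through the free cells from `(p,q)` to `(N,M)` yields a greedy step, unless
`(p,q)` is `(N,M)`. -/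
theorem eq_last_of_stuck [Finite ι] [Finite κ] {N : ι} {M : κ} (hN : ∀ i, i ≤ N) (hM : ∀ j, j ≤ M)
    (hα : Monotone α) (hβ : Monotone β)
    (hα' : ∀ i, p ≤ i → ∃ t, α t = i) (hβ' : ∀ j, q ≤ j → ∃ t, β t = j)
    (hαp : ∀ t, p ≤ α t) (hβq : ∀ t, q ≤ β t)
    (hfree : ∀ t, a (α t) + b (β t) ≤ δ) (hpq : a p + b q ≤ δ)
    (hno : ∀ r, ¬ GreedyStep (fun i j => a i + b j ≤ δ) p q r)
    (hno' : ∀ r, ¬ GreedyStep (fun j i => b j + a i ≤ δ) q p r) : p = N ∧ q = M := by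
  have h1 := forall_free_of_stuck hα hβ hα' hβ' hβq hαp hfree hpq hno hno'
  have h2 := forall_free_of_stuck hβ hα hβ' hα' hαp hβq
    (fun t => by linarith [hfree t]) (by linarith) hno' hno
  by_contra hne
  have key : (∃ k, q < k ∧ ∀ i, p < i → δ < a i + b k) ∧
      ∃ i, p < i ∧ ∀ k, q < k → δ < b k + a i := by
    by_cases hp : p = N
    · have hq : q < M := (hM q).lt_of_ne fun hq => hne ⟨hp, hq⟩
      obtain ⟨i, hi, -⟩ := exists_blocking hq hno' h2
      exact absurd (hN i) (not_le.2 (hp ▸ hi))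
    · have hp : p < N := (hN p).lt_of_ne hp
      obtain ⟨k, hk, hk'⟩ := exists_blocking hp hno h1
      exact ⟨⟨k, hk, hk'⟩, exists_blocking (hk.trans_le (hM k)) hno' h2⟩
  obtain ⟨⟨k, hk, hk'⟩, i, hi, hi'⟩ := key
  obtain ⟨t, ht⟩ := hα' i hi.le
  obtain ⟨t', ht'⟩ := hβ' k hk.le
  have hβt : β t = q := by
    by_contra h
    have := hi' _ ((hβq t).lt_of_ne (Ne.symm h))
    have := hfree t
    rw [ht] at this
    linarith
  have hαt : α t' = p := by
    by_contra h
    have := hk' _ ((hαp t').lt_of_ne (Ne.symm h))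
    have := hfree t'
    rw [ht'] at this
    linarith
  rcases le_total t t' with h | h
  · exact absurd (hα h) (by rw [ht, hαt]; exact not_le.2 hi)
  · exact absurd (hβ h) (by rw [ht', hβt]; exact not_le.2 hk)

end Stuck

section Distance

variable {n m : ℕ} {π : Fin n → ℝ} {σ : Fin m → ℝ} {δ : ℝ}

theorem le_width (φ : Traversal n × Traversal m) (t : unitInterval) :
    dist (π (φ.1.1 t)) (σ (φ.2.1 t)) ≤ width π σ φ := by
  refine le_ciSup (f := fun t => dist (π (φ.1.1 t)) (σ (φ.2.1 t))) (Set.Finite.bddAbove ?_) t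
  refine (Set.finite_range fun x : Fin n × Fin m => dist (π x.1) (σ x.2)).subset ?_
  rintro _ ⟨t, rfl⟩
  exact ⟨(φ.1.1 t, φ.2.1 t), rfl⟩

theorem width_mem (φ : Traversal n × Traversal m) :
    width π σ φ ∈ Set.range fun x : Fin n × Fin m => dist (π x.1) (σ x.2) := by
  have hsub : (Set.range fun t => dist (π (φ.1.1 t)) (σ (φ.2.1 t))) ⊆
      Set.range fun x : Fin n × Fin m => dist (π x.1) (σ x.2) := by
    rintro _ ⟨t, rfl⟩
    exact ⟨(φ.1.1 t, φ.2.1 t), rfl⟩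
  exact hsub (Set.Nonempty.csSup_mem (Set.range_nonempty _) ((Set.finite_range _).subset hsub))

theorem discreteFrechet_le (φ : Traversal n × Traversal m)
    (h : ∀ t, dist (π (φ.1.1 t)) (σ (φ.2.1 t)) ≤ δ) : discreteFrechet π σ ≤ δ := by
  refine (ciInf_le ⟨0, ?_⟩ φ).trans (ciSup_le h)
  rintro _ ⟨ψ, rfl⟩
  exact dist_nonneg.trans (le_width ψ 0)

/-- The infimum in the discrete Fréchet distance is attained, because widths are distances of
vertices. -/
theorem exists_traversal [Nonempty (Traversal n × Traversal m)] (h : discreteFrechet π σ ≤ δ) :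
    ∃ φ : Traversal n × Traversal m, ∀ t, dist (π (φ.1.1 t)) (σ (φ.2.1 t)) ≤ δ := by
  obtain ⟨φ, hφ⟩ := Set.Nonempty.csInf_mem (Set.range_nonempty (width π σ))
    ((Set.finite_range fun x : Fin n × Fin m => dist (π x.1) (σ x.2)).subset
      (by rintro _ ⟨φ, rfl⟩; exact width_mem φ))
  exact ⟨φ, fun t => (le_width φ t).trans (hφ.le.trans h)⟩

/-- A monotone sequence through all indices up to the last one, as a traversal. -/
theorem exists_traversal_of_seq [NeZero n] {f : ℕ → Fin n} (hf : Monotone f) {r : ℕ}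
    (hsurj : ∀ i, ∃ k ≤ r, f k = i) :
    Monotone (fun t : unitInterval => f ⌊(t : ℝ) * r⌋₊) ∧
      Function.Surjective fun t : unitInterval => f ⌊(t : ℝ) * r⌋₊ := by
  constructor
  · intro s t hst
    exact hf (Nat.floor_mono (mul_le_mul_of_nonneg_right hst (Nat.cast_nonneg r)))
  · intro i
    obtain ⟨k, hk, rfl⟩ := hsurj i
    rcases Nat.eq_zero_or_pos r with rfl | hr
    · obtain rfl : k = 0 := by omega
      exact ⟨0, by simp⟩
    · have hr' : (0 : ℝ) < r := by exact_mod_cast hr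
      refine ⟨⟨k / r, by positivity, ?_⟩, ?_⟩
      · rw [div_le_one hr']; exact_mod_cast hk
      · simp [div_mul_cancel₀ _ hr'.ne']

theorem nonempty_traversal [NeZero n] : Nonempty (Traversal n) := by
  refine ⟨⟨_, exists_traversal_of_seq (n := n) (f := fun k => Fin.ofNat n (min k (n - 1)))
    (r := n - 1) ?_ ?_⟩⟩
  · intro k l hkl
    have hn := NeZero.pos n
    rw [Fin.le_def]
    simp only [Fin.ofNat]
    rw [Nat.mod_eq_of_lt (by omega), Nat.mod_eq_of_lt (by omega)]
    omega
  · intro i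
    refine ⟨i, by omega, Fin.ext ?_⟩
    simp only [Fin.ofNat]
    rw [Nat.mod_eq_of_lt (by omega)]
    omega

/-- `(p,q)` is reached from the first pair of indices by a monotone path through the pairs of
vertices at distance at most `δ` that skips no vertex of either curve. The path stays at `(p,q)`
after time `r`. -/
def FreelyReachable [NeZero n] [NeZero m] (π : Fin n → ℝ) (σ : Fin m → ℝ) (δ : ℝ)
    (p : Fin n) (q : Fin m) : Prop :=
  ∃ (r : ℕ) (f : ℕ → Fin n) (g : ℕ → Fin m), Monotone f ∧ Monotone g ∧
    (∀ k, r ≤ k → f k = p ∧ g k = q) ∧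
    (∀ i ≤ p, ∃ k ≤ r, f k = i) ∧ (∀ j ≤ q, ∃ k ≤ r, g k = j) ∧
    ∀ k, dist (π (f k)) (σ (g k)) ≤ δ

variable [NeZero n] [NeZero m]

theorem freelyReachable_zero (h : dist (π 0) (σ 0) ≤ δ) : FreelyReachable π σ δ 0 0 :=
  ⟨0, fun _ => 0, fun _ => 0, monotone_const, monotone_const, fun _ _ => ⟨rfl, rfl⟩,
    fun _ hi => ⟨0, le_rfl, (nonpos_iff_eq_zero.1 hi).symm⟩,
    fun _ hi => ⟨0, le_rfl, (nonpos_iff_eq_zero.1 hi).symm⟩, fun _ => h⟩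

/-- A path may be extended from `(p,q)` to `(p',q')` if both coordinates increase by at most
one. -/
theorem FreelyReachable.extend {p p' : Fin n} {q q' : Fin m} (h : FreelyReachable π σ δ p q)
    (hp : p ≤ p') (hp' : (p' : ℕ) ≤ p + 1) (hq : q ≤ q') (hq' : (q' : ℕ) ≤ q + 1)
    (hd : dist (π p') (σ q') ≤ δ) : FreelyReachable π σ δ p' q' := by
  obtain ⟨r, f, g, hf, hg, hr, hfs, hgs, hfg⟩ := h
  have mono : ∀ {l : ℕ} {u : ℕ → Fin l} {x y : Fin l}, Monotone u → (∀ k, r ≤ k → u k = x) →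
      x ≤ y → Monotone fun k => if k ≤ r then u k else y := by
    intro l u x y hu hx hxy k k' hkk
    dsimp only
    split_ifs with h1 h2
    · exact hu hkk
    · exact (hu h1).trans ((hx r le_rfl).trans_le hxy)
    · omega
    · exact le_rfl
  have surj : ∀ {l : ℕ} {u : ℕ → Fin l} {x y : Fin l}, (∀ i ≤ x, ∃ k ≤ r, u k = i) →
      x ≤ y → (y : ℕ) ≤ x + 1 → ∀ i ≤ y, ∃ k ≤ r + 1, (if k ≤ r then u k else y) = i := by
    intro l u x y hs hxy hy i hi
    by_cases hix : i ≤ x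
    · obtain ⟨k, hk, hk'⟩ := hs i hix
      exact ⟨k, by omega, by simp [hk, hk']⟩
    · refine ⟨r + 1, le_rfl, ?_⟩
      simp only [Fin.le_def] at *
      simp only [Nat.not_succ_le_self, ↓reduceIte]
      exact Fin.ext (by omega)
  refine ⟨r + 1, fun k => if k ≤ r then f k else p', fun k => if k ≤ r then g k else q',
    mono hf (fun k hk => (hr k hk).1) hp, mono hg (fun k hk => (hr k hk).2) hq, ?_,
    surj hfs hp hp', surj hgs hq hq', ?_⟩
  · intro k hk
    simp [show ¬ k ≤ r by omega]
  · intro k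
    dsimp only
    split_ifs
    · exact hfg k
    · exact hd

theorem FreelyReachable.of_reach_pi {p : Fin n} {q : Fin m} (h : FreelyReachable π σ δ p q) :
    ∀ p' : Fin n, p ≤ p' → (∀ i, p < i → i ≤ p' → dist (π i) (σ q) ≤ δ) →
      FreelyReachable π σ δ p' q := by
  suffices H : ∀ d : ℕ, ∀ p' : Fin n, (p' : ℕ) = p + d →
      (∀ i, p < i → i ≤ p' → dist (π i) (σ q) ≤ δ) → FreelyReachable π σ δ p' q from
    fun p' hp => H (p' - p) p' (by have := Fin.le_def.1 hp; omega)
  intro d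
  induction d with
  | zero =>
    intro p' hp _
    rwa [show p' = p from Fin.ext hp]
  | succ d ih =>
    intro p' hp hi
    have hlt : (p : ℕ) + d < n := by omega
    refine (ih ⟨p + d, hlt⟩ rfl fun i h1 h2 => hi i h1 ?_).extend ?_ ?_ le_rfl (by omega)
      (hi p' ?_ le_rfl)
    · simp only [Fin.le_def] at *; omega
    · simp only [Fin.le_def]; omega
    · simp only; omega
    · simp only [Fin.lt_def]; omega

theorem FreelyReachable.swap {p : Fin n} {q : Fin m} (h : FreelyReachable π σ δ p q) :
    FreelyReachable σ π δ q p := by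
  obtain ⟨r, f, g, hf, hg, hr, hfs, hgs, hfg⟩ := h
  exact ⟨r, g, f, hg, hf, fun k hk => (hr k hk).symm, hgs, hfs, fun k => by
    rw [dist_comm]; exact hfg k⟩

theorem FreelyReachable.discreteFrechet_le {p : Fin n} {q : Fin m}
    (h : FreelyReachable π σ δ p q) (hp : ∀ i, i ≤ p) (hq : ∀ j, j ≤ q) :
    discreteFrechet π σ ≤ δ := by
  obtain ⟨r, f, g, hf, hg, -, hfs, hgs, hfg⟩ := h
  exact GreedyFrechet.discreteFrechet_le
    (⟨_, exists_traversal_of_seq hf fun i => hfs i (hp i)⟩,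
      ⟨_, exists_traversal_of_seq hg fun i => hgs i (hq i)⟩) fun t => hfg _

end Distance

section Run

variable {n m : ℕ} {π : Fin n → ℝ} {σ : Fin m → ℝ} {δ : ℝ}

theorem UpdatePi.le {p p' : Fin n} {q : Fin m} (h : UpdatePi π σ δ p q p') : p ≤ p' := by
  rcases h with h | ⟨rfl, -⟩
  · exact h.1.1.le
  · exact le_rfl

theorem UpdateSigma.le {p : Fin n} {q q' : Fin m} (h : UpdateSigma π σ δ p q q') : q ≤ q' := by
  rcases h with h | ⟨rfl, -⟩
  · exact h.1.1.le
  · exact le_rfl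

theorem LoopStep.add_lt {x y : Fin n × Fin m} (h : LoopStep π σ δ x y) :
    (x.1 : ℕ) + x.2 < y.1 + y.2 := by
  have h1 := Fin.le_def.1 h.1.1.le
  have h2 := Fin.le_def.1 h.1.2.le
  by_contra h3
  exact h.2 (Prod.ext (Fin.ext (by omega)) (Fin.ext (by omega)))

theorem length_le_of_isChain (L : List (Fin n × Fin m)) (x : Fin n × Fin m)
    (hL : (x :: L).IsChain (LoopStep π σ δ)) :
    (x :: L).length + (x.1 + x.2) < n + m := by
  induction L generalizing x with
  | nil => simp only [List.length_singleton]; omega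
  | cons y L ih =>
    rw [List.isChain_cons_cons] at hL
    have := ih y hL.2
    have := hL.1.add_lt
    simp only [List.length_cons] at *
    omega

theorem length_lt_of_isPartialRun [NeZero n] [NeZero m] {L : List (Fin n × Fin m)}
    (hL : IsPartialRun π σ δ L) : L.length < n + m := by
  obtain ⟨h1, h2⟩ := hL
  cases L with
  | nil => simp at h1
  | cons x L =>
    have := length_le_of_isChain L x h2
    omega

/-- A property of the first pair that is preserved by the loop holds at the last pair. -/
theorem induction_on_run [NeZero n] [NeZero m] {P : Fin n × Fin m → Prop}
    {L : List (Fin n × Fin m)} (hL : IsPartialRun π σ δ L) (h0 : P (0, 0))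
    (hstep : ∀ x y, P x → LoopStep π σ δ x y → P y) {x : Fin n × Fin m}
    (hx : L.getLast? = some x) : P x := by
  obtain ⟨h1, h2⟩ := hL
  have key : ∀ (L : List (Fin n × Fin m)) (y : Fin n × Fin m), P y →
      (y :: L).IsChain (LoopStep π σ δ) → ∀ z, (y :: L).getLast? = some z → P z := by
    intro L
    induction L with
    | nil => intro y hy _ z hz; simp at hz; exact hz ▸ hy
    | cons w L ih =>
      intro y hy hc z hz
      rw [List.isChain_cons_cons] at hc
      exact ih w (hstep _ _ hy hc.1) hc.2 z (by rwa [List.getLast?_cons_cons] at hz)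
  cases L with
  | nil => simp at h1
  | cons y L =>
    simp only [List.head?_cons, Option.some.injEq] at h1
    subst h1
    exact key L _ h0 h2 x hx

theorem freelyReachable_of_loopStep [NeZero n] [NeZero m] (hsep : Separated π σ)
    {x y : Fin n × Fin m} (hx : FreelyReachable π σ δ x.1 x.2) (h : LoopStep π σ δ x y) :
    FreelyReachable π σ δ y.1 y.2 := by
  obtain ⟨⟨hu, hv⟩, -⟩ := h
  have h1 : FreelyReachable π σ δ y.1 x.2 := by
    refine hx.of_reach_pi _ hu.le fun i h1 h2 => ?_
    rcases hu with hu | ⟨hu, -⟩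
    · exact (hsep.dist_le_iff _ _).2 ((isGreedyStepPi_iff.1 hu).2.1 i h1 h2)
    · exact absurd (h1.trans_le h2) (hu ▸ lt_irrefl _)
  refine (h1.swap.of_reach_pi _ hv.le fun i h1 h2 => ?_).swap
  rcases hv with hv | ⟨hv, -⟩
  · rw [dist_comm]
    exact (hsep.dist_le_iff _ _).2 ((isGreedyStepSigma_iff.1 hv).2.1 i h1 h2)
  · exact absurd (h1.trans_le h2) (hv ▸ lt_irrefl _)

/-- Raising the first coordinate of a path to at least `p'` keeps it in the free cells if `p'` is
a greedy step. -/
theorem GreedyStep.free_max {ι κ : Type*} [LinearOrder ι] [LinearOrder κ] {F : ι → κ → Prop}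
    {p p' i : ι} {q k : κ} (h : GreedyStep F p q p') (hq : q ≤ k) (hF : F (max i p) k) :
    F (max i p') k := by
  rcases le_total p' i with hi | hi
  · rwa [max_eq_left hi, ← max_eq_left (h.1.le.trans hi)]
  · rw [max_eq_right hi]
    exact h.2.2 _ (le_max_right _ _) (max_le hi h.1.le) k hq hF

/-- The answer of the greedy algorithm is correct. A pair of traversals of width at most `δ`,
with coordinates raised to at least the current pair `(p,q)`, remains a free path throughout the
loop, and at the end of the loop it forces `(p,q)` to be the last pair. -/
theorem greedyExecution_correct [NeZero n] [NeZero m] (hsep : Separated π σ)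
    {L : List (Fin n × Fin m)} {b : Bool} (h : GreedyExecution π σ δ L b) :
    b = true ↔ discreteFrechet π σ ≤ δ := by
  have hn := NeZero.pos n
  have hm := NeZero.pos m
  have : Nonempty (Traversal n) := nonempty_traversal
  have : Nonempty (Traversal m) := nonempty_traversal
  rcases h with ⟨hd, -, rfl⟩ | ⟨hd, hL, x, hx, hend, hb⟩
  · simp only [Bool.false_eq_true, false_iff]
    intro hF
    obtain ⟨φ, hφ⟩ := exists_traversal hF
    obtain ⟨t, ht⟩ := φ.1.2.2 0
    obtain ⟨s, hs⟩ := φ.2.2.2 0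
    have h1 := φ.1.2.1 (show (0 : unitInterval) ≤ t from bot_le)
    have h2 := φ.2.2.1 (show (0 : unitInterval) ≤ s from bot_le)
    rw [ht, nonpos_iff_eq_zero] at h1
    rw [hs, nonpos_iff_eq_zero] at h2
    have := hφ 0
    rw [h1, h2] at this
    linarith
  rw [hb]
  constructor
  · rintro ⟨h1, h2⟩
    have := induction_on_run (P := fun x => FreelyReachable π σ δ x.1 x.2) hL
      (freelyReachable_zero hd) (fun _ _ => freelyReachable_of_loopStep hsep) hx
    refine this.discreteFrechet_le (fun i => ?_) (fun i => ?_) <;> rw [Fin.le_def] <;> omega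
  · intro hF
    obtain ⟨φ, hφ⟩ := exists_traversal hF
    have hinv := induction_on_run (P := fun x =>
        (∀ t, π (max (φ.1.1 t) x.1) - σ (max (φ.2.1 t) x.2) ≤ δ) ∧ π x.1 - σ x.2 ≤ δ) hL
      ⟨fun t => by
        rw [max_eq_left zero_le, max_eq_left zero_le]
        exact (hsep.dist_le_iff _ _).1 (hφ t), (hsep.dist_le_iff _ _).1 hd⟩ ?_ hx
    · obtain ⟨hinv, hxf⟩ := hinv
      have hlast := eq_last_of_stuck (a := π) (b := fun j => - σ j) (δ := δ) (p := x.1) (q := x.2)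
        (N := ⟨n - 1, by omega⟩) (M := ⟨m - 1, by omega⟩)
        (α := fun t => max (φ.1.1 t) x.1) (β := fun t => max (φ.2.1 t) x.2)
        (fun i => by rw [Fin.le_def]; simp only; omega)
        (fun i => by rw [Fin.le_def]; simp only; omega)
        (fun s t hst => max_le_max_right _ (φ.1.2.1 hst))
        (fun s t hst => max_le_max_right _ (φ.2.2.1 hst))
        (fun i hi => (φ.1.2.2 i).imp fun t ht => by rw [ht, max_eq_left hi])
        (fun i hi => (φ.2.2.2 i).imp fun t ht => by rw [ht, max_eq_left hi])
        (fun t => le_max_right _ _) (fun t => le_max_right _ _)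
        (fun t => by linarith [hinv t]) (by linarith)
        (fun r hr => hend.1 r (isGreedyStepPi_iff.2 (by simpa only [sub_eq_add_neg] using hr)))
        (fun r hr => hend.2 r (isGreedyStepSigma_iff.2
          (by simpa only [sub_eq_add_neg, add_comm] using hr)))
      rw [hlast.1, hlast.2]
      simp only
      omega
    · rintro x y ⟨h1, h2⟩ ⟨⟨hu, hv⟩, -⟩
      have h3 : (∀ t, π (max (φ.1.1 t) y.1) - σ (max (φ.2.1 t) x.2) ≤ δ) ∧ π y.1 - σ x.2 ≤ δ := by
        rcases hu with hu | ⟨hu, -⟩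
        · have hu := isGreedyStepPi_iff.1 hu
          exact ⟨fun t => hu.free_max (le_max_right _ _) (h1 t), hu.2.1 _ hu.1 le_rfl⟩
        · rw [hu]; exact ⟨h1, h2⟩
      rcases hv with hv | ⟨hv, -⟩
      · have hv := isGreedyStepSigma_iff.1 hv
        exact ⟨fun t => hv.free_max (F := fun j i => π i - σ j ≤ δ) (le_max_right _ _) (h3.1 t),
          hv.2.1 _ hv.1 le_rfl⟩
      · rw [hv]; exact h3

end Run

/-! ### Total correctness with running time -/

/-- Started in `s`, the program `P` halts after at most `T` operations in a configuration that
satisfies `Q`. -/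
def Runs (P : Prog) (s : State) (T : ℕ) (Q : State → Prop) : Prop :=
  ∃ t s', Exec P s t s' ∧ t ≤ T ∧ Q s'

theorem Runs.mono {P : Prog} {s : State} {T T' : ℕ} {Q Q' : State → Prop} (h : Runs P s T Q)
    (hT : T ≤ T') (hQ : ∀ s', Q s' → Q' s') : Runs P s T' Q' := by
  obtain ⟨t, s', h1, h2, h3⟩ := h
  exact ⟨t, s', h1, h2.trans hT, hQ _ h3⟩

theorem Runs.seq {P R : Prog} {s : State} {T T' : ℕ} {Q Q' : State → Prop} (h : Runs P s T Q)
    (h' : ∀ s', Q s' → Runs R s' T' Q') : Runs (.seq P R) s (T + T') Q' := by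
  obtain ⟨t, s', h1, h2, h3⟩ := h
  obtain ⟨t', s'', h1', h2', h3'⟩ := h' s' h3
  exact ⟨_, s'', .seq h1 h1', by omega, h3'⟩

theorem Runs.branch {c : Test} {P R : Prog} {s : State} {T' : ℕ} {Q : State → Prop} (T : ℕ)
    (h1 : c.holds s → Runs P s T Q) (h2 : ¬ c.holds s → Runs R s T Q) (hT : c.cost + 1 + T ≤ T') :
    Runs (.branch c P R) s T' Q := by
  by_cases hc : c.holds s
  · obtain ⟨t, s', h, ht, hQ⟩ := h1 hc
    exact ⟨_, s', .branchTrue hc h, by omega, hQ⟩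
  · obtain ⟨t, s', h, ht, hQ⟩ := h2 hc
    exact ⟨_, s', .branchFalse hc h, by omega, hQ⟩

/-- Loop rule: `I k` is an invariant whose parameter `k` bounds the number of remaining
iterations. -/
theorem Runs.loop {c : Test} {P : Prog} {T : ℕ} (I : ℕ → State → Prop)
    (hstep : ∀ k s, I k s → c.holds s → Runs P s T fun s' => ∃ k' < k, I k' s') :
    ∀ k s, I k s → Runs (.loop c P) s (k * (T + c.cost + 1) + (c.cost + 1))
      fun s' => (∃ k', I k' s') ∧ ¬ c.holds s' := by
  intro k
  induction k using Nat.strong_induction_on with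
  | _ k ih =>
    intro s hI
    by_cases hc : c.holds s
    · obtain ⟨t, s', h1, h2, k', hk', hI'⟩ := hstep k s hI hc
      obtain ⟨t', s'', h1', h2', hQ⟩ := ih k' hk' s' hI'
      refine ⟨_, s'', .loopStep hc h1 h1', ?_, hQ⟩
      have : (k' + 1) * (T + c.cost + 1) ≤ k * (T + c.cost + 1) :=
        Nat.mul_le_mul_right _ hk'
      rw [add_mul, one_mul] at this
      omega
    · exact ⟨_, s, .loopEnd hc, by omega, ⟨k, hI⟩, hc⟩

/-- Programs without loops. -/
def Prog.LoopFree : Prog → Prop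
  | .seq P Q => P.LoopFree ∧ Q.LoopFree
  | .branch _ P Q => P.LoopFree ∧ Q.LoopFree
  | .loop _ _ => False
  | _ => True

open Classical in
/-- The final configuration of a program without loops. -/
noncomputable def Prog.run : Prog → State → State
  | .setI x e, s => { s with ivar := Function.update s.ivar x (e.eval s) }
  | .setR x e, s => { s with rvar := Function.update s.rvar x (e.eval s) }
  | .storeI a i e, s => { s with iarr := setCell s.iarr a (i.eval s) (e.eval s) }
  | .storeR a i e, s => { s with rarr := setCell s.rarr a (i.eval s) (e.eval s) }
  | .emit e, s => { s with out := s.out ++ [e.eval s] }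
  | .seq P Q, s => Q.run (P.run s)
  | .branch c P Q, s => if c.holds s then P.run s else Q.run s
  | .loop _ _, s => s

/-- A bound on the running time of a program without loops. -/
def Prog.time : Prog → ℕ
  | .setI _ e => e.cost + 1
  | .setR _ e => e.cost + 1
  | .storeI _ i e => i.cost + e.cost + 1
  | .storeR _ i e => i.cost + e.cost + 1
  | .emit e => e.cost + 1
  | .seq P Q => P.time + Q.time
  | .branch c P Q => c.cost + 1 + max P.time Q.time
  | .loop _ _ => 0

theorem Prog.runs_run (P : Prog) (hP : P.LoopFree) (s : State) :
    Runs P s P.time (fun s' => s' = P.run s) := by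
  induction P generalizing s with
  | setI x e => exact ⟨_, _, .setI x e s, le_rfl, rfl⟩
  | setR x e => exact ⟨_, _, .setR x e s, le_rfl, rfl⟩
  | storeI a i e => exact ⟨_, _, .storeI a i e s, le_rfl, rfl⟩
  | storeR a i e => exact ⟨_, _, .storeR a i e s, le_rfl, rfl⟩
  | emit e => exact ⟨_, _, .emit e s, le_rfl, rfl⟩
  | seq P Q ihP ihQ =>
    refine (ihP hP.1 s).seq ?_
    rintro _ rfl
    exact ihQ hP.2 _
  | branch c P Q ihP ihQ =>
    refine Runs.branch _ (fun hc => (ihP hP.1 s).mono (le_max_left _ _) ?_)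
      (fun hc => (ihQ hP.2 s).mono (le_max_right _ _) ?_) le_rfl
    · rintro _ rfl; simp [Prog.run, hc]
    · rintro _ rfl; simp [Prog.run, hc]
  | loop c P => exact hP.elim

theorem Runs.of_loopFree {P : Prog} {s : State} {T : ℕ} {Q : State → Prop} (hP : P.LoopFree)
    (hT : P.time ≤ T) (hQ : Q (P.run s)) : Runs P s T Q :=
  (P.runs_run hP s).mono hT (by rintro _ rfl; exact hQ)

theorem setCell_apply {α : Type} (A : ℕ → ℕ → α) (a i : ℕ) (v : α) (b j : ℕ) :
    setCell A a i v b j = if b = a ∧ j = i then v else A b j := by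
  unfold setCell
  by_cases h : b = a
  · subst h
    by_cases h' : j = i
    · subst h'; simp
    · simp [h']
  · simp [h]

theorem Runs.loopFree_seq {P R : Prog} {s : State} {T T' : ℕ} {Q : State → Prop}
    (hP : P.LoopFree) (h : Runs R (P.run s) T Q) (hT : P.time + T ≤ T') :
    Runs (.seq P R) s T' Q :=
  ((P.runs_run hP s).seq (by rintro _ rfl; exact h)).mono hT fun _ h => h

@[simp] theorem setCell_of_ne {α : Type} (A : ℕ → ℕ → α) {a b : ℕ} (h : b ≠ a) (i : ℕ) (v : α) :
    setCell A a i v b = A b := Function.update_of_ne h _ _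

/-- The configurations `s` and `s'` differ at most in the integer variables in `I` and in the
integer arrays in `A`. -/
structure SameExcept (I A : List ℕ) (s s' : State) : Prop where
  rvar : s'.rvar = s.rvar
  rarr : s'.rarr = s.rarr
  out : s'.out = s.out
  ivar : ∀ x, x ∉ I → s'.ivar x = s.ivar x
  iarr : ∀ a, a ∉ A → s'.iarr a = s.iarr a

theorem SameExcept.refl (I A : List ℕ) (s : State) : SameExcept I A s s :=
  ⟨rfl, rfl, rfl, fun _ _ => rfl, fun _ _ => rfl⟩

theorem SameExcept.trans {I A : List ℕ} {s s' s'' : State} (h : SameExcept I A s s')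
    (h' : SameExcept I A s' s'') : SameExcept I A s s'' :=
  ⟨h'.rvar.trans h.rvar, h'.rarr.trans h.rarr, h'.out.trans h.out,
    fun x hx => (h'.ivar x hx).trans (h.ivar x hx), fun a ha => (h'.iarr a ha).trans (h.iarr a ha)⟩

/-- `P` assigns only to the integer variables in `I` and the integer arrays in `A`, and has no
output. -/
def Prog.WritesOnly (I A : List ℕ) : Prog → Prop
  | .setI x _ => x ∈ I
  | .setR _ _ => False
  | .storeI a _ _ => a ∈ A
  | .storeR _ _ _ => False
  | .emit _ => False
  | .seq P Q => P.WritesOnly I A ∧ Q.WritesOnly I A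
  | .branch _ P Q => P.WritesOnly I A ∧ Q.WritesOnly I A
  | .loop _ P => P.WritesOnly I A

theorem Exec.sameExcept {P : Prog} {s s' : State} {t : ℕ} {I A : List ℕ} (h : Exec P s t s')
    (hP : P.WritesOnly I A) : SameExcept I A s s' := by
  induction h with
  | setI x e s =>
    exact ⟨rfl, rfl, rfl, fun y hy => Function.update_of_ne (by rintro rfl; exact hy hP) _ _,
      fun _ _ => rfl⟩
  | storeI a i e s =>
    exact ⟨rfl, rfl, rfl, fun _ _ => rfl,
      fun y hy => Function.update_of_ne (by rintro rfl; exact hy hP) _ _⟩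
  | setR | storeR | emit => exact hP.elim
  | seq _ _ ih1 ih2 => exact (ih1 hP.1).trans (ih2 hP.2)
  | branchTrue _ _ ih => exact ih hP.1
  | branchFalse _ _ ih => exact ih hP.2
  | loopEnd => exact .refl _ _ _
  | loopStep _ _ _ ih1 ih2 => exact (ih1 hP).trans (ih2 hP)

theorem Runs.frame {P : Prog} {s : State} {T : ℕ} {Q : State → Prop} (I A : List ℕ)
    (hP : P.WritesOnly I A) (h : Runs P s T Q) :
    Runs P s T fun s' => SameExcept I A s s' ∧ Q s' := by
  obtain ⟨t, s', h1, h2, h3⟩ := h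
  exact ⟨t, s', h1, h2, h1.sameExcept hP, h3⟩

/-- Counting loop: `Inv x` is an invariant before the iteration with number `x`, of `N`. The
variables and arrays that the body does not assign to stay as they are. -/
theorem Runs.count {c : Test} {P : Prog} {T' : ℕ} {Q : State → Prop} (N T : ℕ)
    (Inv : ℕ → State → Prop) {s : State} (I A : List ℕ) (hP : P.WritesOnly I A) (h0 : Inv 0 s)
    (hc : ∀ x s', x ≤ N → SameExcept I A s s' → Inv x s' → (c.holds s' ↔ x < N))
    (hstep : ∀ x s', x < N → SameExcept I A s s' → Inv x s' → Runs P s' T (Inv (x + 1)))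
    (hT : N * (T + c.cost + 1) + (c.cost + 1) ≤ T')
    (hQ : ∀ s', SameExcept I A s s' → Inv N s' → Q s') :
    Runs (.loop c P) s T' Q := by
  refine (Runs.loop (fun k s' => ∃ x, x + k = N ∧ SameExcept I A s s' ∧ Inv x s') ?_ N s
    ⟨0, by omega, .refl _ _ _, h0⟩).mono hT ?_
  · rintro k s' ⟨x, hx, hs, hI⟩ h
    have hlt := (hc x s' (by omega) hs hI).1 h
    exact ((hstep x s' hlt hs hI).frame I A hP).mono le_rfl fun s'' hs'' =>
      ⟨k - 1, by omega, x + 1, by omega, hs.trans hs''.1, hs''.2⟩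
  · rintro s' ⟨⟨k, x, hx, hs, hI⟩, hn⟩
    rw [hc x s' (by omega) hs hI] at hn
    exact hQ _ hs (by rwa [show x = N by omega] at hI)

/-! ### Notation for programs -/

instance : Add IExp := ⟨IExp.add⟩
instance : Sub IExp := ⟨IExp.sub⟩
instance : Sub RExp := ⟨RExp.sub⟩

@[simp] theorem IExp.eval_add (s : State) (e f : IExp) : (e + f).eval s = e.eval s + f.eval s := rfl
@[simp] theorem IExp.eval_sub (s : State) (e f : IExp) : (e - f).eval s = e.eval s - f.eval s := rfl
@[simp] theorem IExp.eval_lit (s : State) (k : ℕ) : (IExp.lit k).eval s = k := rfl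
@[simp] theorem IExp.eval_var (s : State) (x : ℕ) : (IExp.var x).eval s = s.ivar x := rfl
@[simp] theorem IExp.eval_cell (s : State) (a : ℕ) (i : IExp) :
    (IExp.cell a i).eval s = s.iarr a (i.eval s) := rfl
@[simp] theorem RExp.eval_sub (s : State) (e f : RExp) : (e - f).eval s = e.eval s - f.eval s := rfl
@[simp] theorem RExp.eval_var (s : State) (x : ℕ) : (RExp.var x).eval s = s.rvar x := rfl
@[simp] theorem RExp.eval_cell (s : State) (a : ℕ) (i : IExp) :
    (RExp.cell a i).eval s = s.rarr a (i.eval s) := rfl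

/-- The test `e < f`. -/
abbrev Test.ilt (e f : IExp) : Test := .neg (.ile f e)

@[simp] theorem Test.holds_ile (s : State) (e f : IExp) :
    (Test.ile e f).holds s ↔ e.eval s ≤ f.eval s := Iff.rfl
@[simp] theorem Test.holds_rle (s : State) (e f : RExp) :
    (Test.rle e f).holds s ↔ e.eval s ≤ f.eval s := Iff.rfl
@[simp] theorem Test.holds_neg (s : State) (c : Test) : (Test.neg c).holds s ↔ ¬ c.holds s := Iff.rfl
@[simp] theorem Test.holds_and (s : State) (c d : Test) :
    (Test.and c d).holds s ↔ c.holds s ∧ d.holds s := Iff.rfl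

/-- An assignment that changes nothing. -/
abbrev Prog.skip (x : ℕ) : Prog := .setI x (.var x)

attribute [simp] Prog.run Prog.LoopFree Prog.WritesOnly Prog.time IExp.cost RExp.cost Test.cost
  setCell_apply

@[simp] theorem IExp.cost_add (e f : IExp) : (e + f).cost = e.cost + f.cost + 1 := rfl
@[simp] theorem IExp.cost_sub (e f : IExp) : (e - f).cost = e.cost + f.cost + 1 := rfl
@[simp] theorem RExp.cost_sub (e f : RExp) : (e - f).cost = e.cost + f.cost + 1 := rfl

local infixr:30 " ;; " => Prog.seq

/-! ### First entry above a threshold -/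

/-- `f x` is the maximum of `K` on `[x, x + 2 ^ k)`, cut off at `M`. -/
def IsMaxLevel (K : ℕ → ℕ) (M k : ℕ) (f : ℕ → ℕ) : Prop :=
  ∀ x < M, ∀ c, c ≤ f x ↔ ∃ y, x ≤ y ∧ y < x + 2 ^ k ∧ y < M ∧ c ≤ K y

theorem isMaxLevel_zero (K : ℕ → ℕ) (M : ℕ) : IsMaxLevel K M 0 K := by
  intro x hx c
  constructor
  · intro h; exact ⟨x, le_rfl, by simp, hx, h⟩
  · rintro ⟨y, h1, h2, -, h⟩
    rwa [show x = y by simp at h2; omega]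

theorem IsMaxLevel.succ {K : ℕ → ℕ} {M k : ℕ} {f g : ℕ → ℕ} (hf : IsMaxLevel K M k f)
    (hg : ∀ x < M, g x = if x + 2 ^ k < M ∧ f x ≤ f (x + 2 ^ k) then f (x + 2 ^ k) else f x) :
    IsMaxLevel K M (k + 1) g := by
  intro x hx c
  have key : c ≤ g x ↔ c ≤ f x ∨ (x + 2 ^ k < M ∧ c ≤ f (x + 2 ^ k)) := by
    rw [hg x hx]
    split_ifs <;> omega
  rw [key, hf x hx]
  constructor
  · rintro (⟨y, h1, h2, h3, h4⟩ | ⟨h0, h⟩)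
    · exact ⟨y, h1, by rw [pow_succ]; omega, h3, h4⟩
    · obtain ⟨y, h1, h2, h3, h4⟩ := (hf _ h0 c).1 h
      exact ⟨y, by omega, by rw [pow_succ]; omega, h3, h4⟩
  · rintro ⟨y, h1, h2, h3, h4⟩
    rw [pow_succ] at h2
    by_cases hy : y < x + 2 ^ k
    · exact .inl ⟨y, h1, hy, h3, h4⟩
    · exact .inr ⟨by omega, (hf _ (by omega) c).2 ⟨y, by omega, by omega, h3, h4⟩⟩

/-- The integer array 1 begins with the entries `K 0, …, K (M - 1)` and holds, at offset `k * M`, the level `k` of the table of maxima of `K`, for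
`k < r`; the arrays 2 and 3 hold the powers `2 ^ k` and the offsets. -/
structure TableUpTo (K : ℕ → ℕ) (M r : ℕ) (s : State) : Prop where
  base : ∀ x < M, s.iarr 1 x = K x
  width : ∀ k < r, s.iarr 2 k = 2 ^ k
  offset : ∀ k < r, s.iarr 3 k = k * M
  level : ∀ k < r, IsMaxLevel K M k fun x => s.iarr 1 (k * M + x)

/-- Fill the level at offset `o + M` from the level at offset `o`, where `M`, `o` and the width
of the level are in the variables 8, 10, 11. -/
def levelProg : Prog :=
  .setI 12 (.lit 0) ;;
  .loop (.ilt (.var 12) (.var 8))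
    (.setI 13 (.cell 1 (.var 10 + .var 12)) ;;
     .branch (.and (.ilt (.var 12 + .var 11) (.var 8))
        (.ile (.var 13) (.cell 1 (.var 10 + (.var 12 + .var 11)))))
       (.setI 13 (.cell 1 (.var 10 + (.var 12 + .var 11)))) (.skip 13) ;;
     .storeI 1 (.var 10 + .var 8 + .var 12) (.var 13) ;;
     .setI 12 (.var 12 + .lit 1))

theorem runs_levelProg (s : State) :
    Runs levelProg s (100 * s.ivar 8 + 100) fun s' =>
      (∀ z < s.ivar 10 + s.ivar 8, s'.iarr 1 z = s.iarr 1 z) ∧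
      ∀ x < s.ivar 8, s'.iarr 1 (s.ivar 10 + s.ivar 8 + x) =
        if x + s.ivar 11 < s.ivar 8 ∧
          s.iarr 1 (s.ivar 10 + x) ≤ s.iarr 1 (s.ivar 10 + (x + s.ivar 11)) then
          s.iarr 1 (s.ivar 10 + (x + s.ivar 11)) else s.iarr 1 (s.ivar 10 + x) := by
  obtain ⟨M, hM⟩ : ∃ M, s.ivar 8 = M := ⟨_, rfl⟩
  obtain ⟨o, ho⟩ : ∃ o, s.ivar 10 = o := ⟨_, rfl⟩
  obtain ⟨w, hw⟩ : ∃ w, s.ivar 11 = w := ⟨_, rfl⟩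
  rw [hM, ho, hw]
  refine .loopFree_seq (T := 100 * M + 98) (by simp) ?_ (by simp; omega)
  refine Runs.count M 60 (fun x s' => s'.ivar 12 = x ∧
      (∀ z < o + M, s'.iarr 1 z = s.iarr 1 z) ∧
      ∀ y < x, s'.iarr 1 (o + M + y) =
        if y + w < M ∧ s.iarr 1 (o + y) ≤ s.iarr 1 (o + (y + w)) then
          s.iarr 1 (o + (y + w)) else s.iarr 1 (o + y)) [12, 13] [1] ?_ ?_ ?_ ?_ ?_ ?_
  · simp
  · simp
  · rintro x s' - hs ⟨hx, -⟩
    simp [hx, hs.ivar 8, hM]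
  · rintro x s' hxM hs ⟨hx, h1, h2⟩
    have hi := hs.ivar
    refine .of_loopFree (by simp) (by simp) ?_
    have e8 : s'.ivar 8 = M := by simp [hi 8, hM]
    have e10 : s'.ivar 10 = o := by simp [hi 10, ho]
    have e11 : s'.ivar 11 = w := by simp [hi 11, hw]
    have e1 := h1 (o + x) (by omega)
    have e2 : x + w < M → s'.iarr 1 (o + (x + w)) = s.iarr 1 (o + (x + w)) :=
      fun h => h1 _ (by omega)
    have fin : ∀ v, v = (if x + w < M ∧ s.iarr 1 (o + x) ≤ s.iarr 1 (o + (x + w)) then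
          s.iarr 1 (o + (x + w)) else s.iarr 1 (o + x)) →
        (∀ z < o + M, (if z = o + M + x then v else s'.iarr 1 z) = s.iarr 1 z) ∧
        ∀ y ≤ x, (if y = x then v else s'.iarr 1 (o + M + y)) =
          if y + w < M ∧ s.iarr 1 (o + y) ≤ s.iarr 1 (o + (y + w)) then
            s.iarr 1 (o + (y + w)) else s.iarr 1 (o + y) := by
      intro v hv
      refine ⟨fun z hz => ?_, fun y hy => ?_⟩
      · rw [if_neg (by omega), h1 z hz]
      · by_cases hyx : y = x
        · rw [if_pos hyx, hv, hyx]
        · rw [if_neg hyx, h2 y (by omega)]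
    by_cases hb : x + w < M ∧ s.iarr 1 (o + x) ≤ s.iarr 1 (o + (x + w))
    · have e3 := e2 hb.1
      simpa [hx, e8, e10, e11, e1, e3, hb] using fin _ (if_pos hb).symm
    · have := fin _ (if_neg hb).symm
      by_cases hw' : x + w < M
      · have hle : ¬ s.iarr 1 (o + x) ≤ s.iarr 1 (o + (x + w)) := fun h => hb ⟨hw', h⟩
        simpa [hx, e8, e10, e11, e1, e2 hw', hw', hle] using this
      · simpa [hx, e8, e10, e11, e1, hw'] using this
  · simp; omega
  · rintro s' hs ⟨-, h1⟩
    exact h1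

/-- Build the table of maxima of the entries `0, …, M - 1` of the integer array 1, where `M` is
in the variable 8. The number of levels below the top one is left in the variable 9. -/
def tableProg : Prog :=
  .setI 9 (.lit 0) ;; .setI 10 (.lit 0) ;; .setI 11 (.lit 1) ;;
  .loop (.ilt (.var 11) (.var 8))
    (.storeI 2 (.var 9) (.var 11) ;; .storeI 3 (.var 9) (.var 10) ;;
     levelProg ;;
     .setI 10 (.var 10 + .var 8) ;; .setI 11 (.var 11 + .var 11) ;; .setI 9 (.var 9 + .lit 1))

theorem runs_tableProg (s : State) :
    Runs tableProg s (Nat.clog 2 (s.ivar 8) * (100 * s.ivar 8 + 200) + 50) fun s' =>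
      s'.ivar 9 = Nat.clog 2 (s.ivar 8) ∧
      TableUpTo (s.iarr 1) (s.ivar 8) (Nat.clog 2 (s.ivar 8)) s' := by
  obtain ⟨M, hM⟩ : ∃ M, s.ivar 8 = M := ⟨_, rfl⟩
  rw [hM]
  refine .loopFree_seq (by simp) (.loopFree_seq (by simp) (.loopFree_seq (by simp)
    (T := Nat.clog 2 M * (100 * M + 200) + 10) ?_ le_rfl) le_rfl) (by simp; omega)
  refine Runs.count (Nat.clog 2 M) (100 * M + 150) (fun k s' => s'.ivar 9 = k ∧
      s'.ivar 10 = k * M ∧ s'.ivar 11 = 2 ^ k ∧ TableUpTo (s.iarr 1) M k s' ∧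
      IsMaxLevel (s.iarr 1) M k fun x => s'.iarr 1 (k * M + x))
    [9, 10, 11, 12, 13] [1, 2, 3] ?_ ?_ ?_ ?_ ?_ ?_
  · simp [levelProg]
  · simp
    exact ⟨⟨by simp, by simp, by simp, by simp⟩, isMaxLevel_zero _ _⟩
  · rintro k s' - hs ⟨-, -, h11, -⟩
    simp [h11, hs.ivar 8, hM, Nat.lt_clog_iff_pow_lt]
  · rintro k s' hk hs ⟨h9, h10, h11, ht, hl⟩
    have e8 : s'.ivar 8 = M := by simp [hs.ivar 8, hM]
    refine .loopFree_seq (by simp) (.loopFree_seq (by simp) (T := 100 * M + 130) ?_ le_rfl)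
      (by simp; omega)
    refine ((((runs_levelProg _).frame [12, 13] [1] (by simp [levelProg])).seq
      (T' := 20) fun s'' hs'' => ?_)).mono (Q := fun s'' => _) ?_ fun _ h => h
    rotate_left
    · simp [e8]
    refine .of_loopFree (by simp) (by simp) ?_
    obtain ⟨hf, h1, h2⟩ := hs''
    simp [e8, h9, h10, h11] at h1 h2
    have f9 := hf.ivar 9
    have f10 := hf.ivar 10
    have f11 := hf.ivar 11
    have f8 := hf.ivar 8
    have g2 := hf.iarr 2
    have g3 := hf.iarr 3
    simp [h9, h10, h11, e8] at f8 f9 f10 f11 g2 g3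
    simp [f8, f9, f10, f11]
    refine ⟨by ring, by ring, ⟨fun x hx => ?_, fun l hl' => ?_, fun l hl' => ?_, fun l hl' => ?_⟩, ?_⟩
    · rw [← ht.base x hx]
      exact h1 x (by omega)
    · simp [g2]
      rcases Nat.lt_succ_iff_lt_or_eq.1 hl' with h | h
      · rw [if_neg h.ne]; exact ht.width l h
      · rw [if_pos h, h]
    · simp [g3]
      rcases Nat.lt_succ_iff_lt_or_eq.1 hl' with h | h
      · rw [if_neg h.ne]; exact ht.offset l h
      · rw [if_pos h, h]
    · have hlev : IsMaxLevel (s.iarr 1) M l fun x => s'.iarr 1 (l * M + x) := by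
        rcases Nat.lt_succ_iff_lt_or_eq.1 hl' with h | rfl
        · exact ht.level l h
        · exact hl
      intro x hx c
      have := Nat.mul_le_mul_right M (Nat.lt_succ_iff.1 hl')
      simp only
      rw [h1 _ (by omega)]
      exact hlev x hx c
    · refine hl.succ fun x hx => ?_
      rw [← h2 x hx, add_mul, one_mul]
  · simp
    have := Nat.mul_le_mul_left (Nat.clog 2 M) (show 100 * M + 150 + 4 + 1 ≤ 100 * M + 200 by omega)
    omega
  · rintro s' hs ⟨h9, -, -, ht, -⟩
    exact ⟨h9, ht⟩

/-- First entry at or after `x` of the array 1 that is at least `c`, where `x` and `c` are in the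
variables 20 and 21; the result replaces `x`. -/
def findProg : Prog :=
  .setI 22 (.var 9) ;;
  .loop (.ilt (.lit 0) (.var 22))
    (.setI 22 (.var 22 - .lit 1) ;;
     .branch (.ilt (.cell 1 (.cell 3 (.var 22) + .var 20)) (.var 21))
       (.setI 20 (.var 20 + .cell 2 (.var 22))) (.skip 20))

theorem runs_findProg {K : ℕ → ℕ} {M r : ℕ} {s : State} (ht : TableUpTo K M r s)
    (hr : s.ivar 9 = r) (hM : M ≤ 2 ^ r) {Y : ℕ} (hY : s.ivar 20 ≤ Y) (hYM : Y < M)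
    (hKY : s.ivar 21 ≤ K Y) :
    Runs findProg s (40 * r + 10) fun s' => s.ivar 20 ≤ s'.ivar 20 ∧ s'.ivar 20 ≤ Y ∧
      s.ivar 21 ≤ K (s'.ivar 20) ∧
      ∀ y, s.ivar 20 ≤ y → y < s'.ivar 20 → K y < s.ivar 21 := by
  have hex : ∃ z, s.ivar 20 ≤ z ∧ s.ivar 21 ≤ K z := ⟨Y, hY, hKY⟩
  obtain ⟨z, ⟨hz, hK⟩, hzY, hlt⟩ : ∃ z, (s.ivar 20 ≤ z ∧ s.ivar 21 ≤ K z) ∧ z ≤ Y ∧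
      ∀ y, s.ivar 20 ≤ y → y < z → K y < s.ivar 21 :=
    ⟨Nat.find hex, Nat.find_spec hex, Nat.find_min' hex ⟨hY, hKY⟩, fun y h1 h2 =>
      not_le.1 fun h => Nat.find_min hex h2 ⟨h1, h⟩⟩
  have hzM : z < M := hzY.trans_lt hYM
  refine .loopFree_seq (T := 40 * r + 5) (by simp) ?_ (by simp; omega)
  refine Runs.count r 30 (fun k s' => s'.ivar 22 = r - k ∧ s'.ivar 20 ≤ z ∧
      z < s'.ivar 20 + 2 ^ (r - k) ∧ s.ivar 20 ≤ s'.ivar 20) [20, 22] [] ?_ ?_ ?_ ?_ ?_ ?_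
  · simp
  · simp [hr]; omega
  · rintro k s' hk hs ⟨h22, -⟩
    simp [h22]; omega
  · rintro k s' hk hs ⟨h22, h1, h2, h3⟩
    refine .of_loopFree (by simp) (by simp) ?_
    have hrk : r - k = r - k - 1 + 1 := by omega
    have g1 := hs.iarr 1
    have g2 := hs.iarr 2
    have g3 := hs.iarr 3
    have f21 := hs.ivar 21
    simp at g1 g2 g3 f21
    have e3 := ht.offset (r - k - 1) (by omega)
    have e2 := ht.width (r - k - 1) (by omega)
    have hlev := ht.level (r - k - 1) (by omega) (s'.ivar 20) (by omega) (s.ivar 21)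
    rw [hrk, pow_succ] at h2
    simp only [Nat.sub_add_eq]
    by_cases hc : s.iarr 1 ((r - k - 1) * M + s'.ivar 20) < s.ivar 21
    · have : s'.ivar 20 + 2 ^ (r - k - 1) ≤ z := by
        by_contra hcon
        exact absurd (hlev.2 ⟨z, h1, by omega, hzM, hK⟩) (not_le.2 hc)
      simp [h22, g1, g2, g3, f21, e3, e2, hc]
      omega
    · obtain ⟨y, hy1, hy2, hy3, hy4⟩ := hlev.1 (not_lt.1 hc)
      have hzy : z ≤ y := by
        by_contra hcon
        exact absurd (hlt y (by omega) (by omega)) (not_lt.2 hy4)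
      simp [h22, g1, g3, f21, e3, hc]
      omega
  · simp; omega
  · rintro s' hs ⟨h22, h1, h2, h3⟩
    simp at h2
    have : s'.ivar 20 = z := by omega
    rw [this]
    exact ⟨hz, hzY, hK, hlt⟩

/-! ### Merging sorted blocks -/

section Merge

variable {L : Type*} [LinearOrder L] {κ : ℕ → L} {N w : ℕ} {f g : ℕ → ℕ}

/-- `f` maps `{0, …, N - 1}` onto itself, and `κ ∘ f` is non-decreasing on each of the blocks
`[w r, w (r + 1))`. -/
structure BlockSorted (κ : ℕ → L) (N w : ℕ) (f : ℕ → ℕ) : Prop where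
  range : ∀ y < N, f y < N
  surj : ∀ v < N, ∃ y < N, f y = v
  sorted : ∀ r y y', w * r ≤ y → y < y' → y' < w * (r + 1) → y' < N → κ (f y) ≤ κ (f y')

/-- The state of the merging of the blocks of length `w` of `f` into the blocks of length `2 w`
of `g`. The first `x` entries of `g` have been written. The current block of `g` begins at
`2 w R`; it is merged from the blocks of `f` that end at `mid` and at `hi`, of which the entries
before `i` and `j`, respectively, have been used. -/
structure MergeInv (κ : ℕ → L) (N w : ℕ) (f g : ℕ → ℕ) (R x i mid j hi : ℕ) : Prop where
  mid_eq : mid = 2 * w * R + w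
  hi_eq : hi = 2 * w * R + 2 * w
  le_i : 2 * w * R ≤ i
  i_le : i ≤ mid
  le_j : mid ≤ j
  j_le : j ≤ hi
  x_eq : x + mid = i + j
  j_bound : j = mid ∨ j ≤ N
  range : ∀ y < x, g y < N
  surj : ∀ z < N, z < i ∨ (mid ≤ z ∧ z < j) → ∃ y < x, g y = f z
  sorted : ∀ r y y', 2 * w * r ≤ y → y < y' → y' < 2 * w * (r + 1) → y' < x →
    κ (g y) ≤ κ (g y')
  below : ∀ y, 2 * w * R ≤ y → y < x → ∀ z < N, (i ≤ z ∧ z < mid) ∨ (j ≤ z ∧ z < hi) →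
    κ (g y) ≤ κ (f z)

theorem mergeInv_zero : MergeInv κ N w f g 0 0 0 w w (2 * w) where
  mid_eq := by simp
  hi_eq := by simp
  le_i := by simp
  i_le := Nat.zero_le _
  le_j := le_rfl
  j_le := by omega
  x_eq := rfl
  j_bound := .inl rfl
  range := fun _ h => absurd h (Nat.not_lt_zero _)
  surj := fun z _ h => by omega
  sorted := fun _ _ _ _ _ _ h => absurd h (Nat.not_lt_zero _)
  below := fun _ _ h => absurd h (Nat.not_lt_zero _)

theorem MergeInv.next_block {R x i mid j hi : ℕ} (h : MergeInv κ N w f g R x i mid j hi)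
    (hx : hi ≤ x) : MergeInv κ N w f g (R + 1) x hi (hi + w) (hi + w) (hi + 2 * w) := by
  have := h.i_le
  have := h.j_le
  have := h.x_eq
  have e : 2 * w * (R + 1) = hi := by rw [h.hi_eq]; ring
  refine ⟨by omega, by omega, by omega, by omega, le_rfl, by omega, by omega, .inl rfl, h.range,
    fun z hz hz' => h.surj z hz ?_, h.sorted, fun y hy hyx => ?_⟩ <;> omega

/-- Writing `f u` to position `x` of `g` preserves sortedness if `f u` lies between what has been
written and what remains of the current block. -/
theorem MergeInv.sorted_succ {R x i mid j hi u : ℕ} (h : MergeInv κ N w f g R x i mid j hi)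
    (hx : x < hi) (hu : (i ≤ u ∧ u < mid) ∨ (j ≤ u ∧ u < hi)) (huN : u < N)
    {g' : ℕ → ℕ} (hg : ∀ y < x, g' y = g y) (hgx : g' x = f u) :
    ∀ r y y', 2 * w * r ≤ y → y < y' → y' < 2 * w * (r + 1) → y' < x + 1 →
      κ (g' y) ≤ κ (g' y') := by
  intro r y y' h1 h2 h3 h4
  rcases Nat.lt_succ_iff_lt_or_eq.1 h4 with h4 | rfl
  · rw [hg _ h4, hg _ (h2.trans h4)]
    exact h.sorted r y y' h1 h2 h3 h4
  · rw [hg _ h2, hgx]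
    refine h.below y ?_ h2 u huN hu
    have e1 := h.hi_eq
    have e2 := h.x_eq
    have e3 := h.le_i
    have e4 := h.le_j
    have hR : R < r + 1 := Nat.lt_of_mul_lt_mul_left (a := 2 * w) (by omega)
    exact (Nat.mul_le_mul_left _ (Nat.lt_succ_iff.1 hR)).trans h1

theorem MergeInv.take_left {R x i mid j hi : ℕ} (h : MergeInv κ N w f g R x i mid j hi)
    (hf : BlockSorted κ N w f) (hx : x < hi) (hxN : x < N) (hi' : i < mid)
    (hle : j < hi → j < N → κ (f i) ≤ κ (f j))
    {g' : ℕ → ℕ} (hg : ∀ y < x, g' y = g y) (hgx : g' x = f i) :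
    MergeInv κ N w f g' R (x + 1) (i + 1) mid j hi := by
  have e1 := h.mid_eq
  have e2 := h.hi_eq
  have e3 := h.le_i
  have e4 := h.le_j
  have e5 := h.j_le
  have e6 := h.x_eq
  have e7 := h.j_bound
  have hiN : i < N := by omega
  have b1 : 2 * w * R = w * (2 * R) := by ring
  have b2 : w * (2 * R + 1) = w * (2 * R) + w := by ring
  have b3 : w * (2 * R + 1 + 1) = w * (2 * R) + 2 * w := by ring
  refine ⟨e1, e2, by omega, hi', e4, e5, by omega, e7, fun y hy => ?_, fun z hz hz' => ?_,
    h.sorted_succ hx (.inl ⟨le_rfl, hi'⟩) hiN hg hgx, fun y hy hyx z hz hz' => ?_⟩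
  · rcases Nat.lt_succ_iff_lt_or_eq.1 hy with hy | rfl
    · rw [hg _ hy]; exact h.range y hy
    · rw [hgx]; exact hf.range i hiN
  · by_cases hzi : z = i
    · exact ⟨x, by omega, by rw [hgx, hzi]⟩
    · obtain ⟨y, hy, hy'⟩ := h.surj z hz (by omega)
      exact ⟨y, by omega, by rw [hg y hy, hy']⟩
  · rcases Nat.lt_succ_iff_lt_or_eq.1 hyx with hyx | rfl
    · rw [hg _ hyx]; exact h.below y hy hyx z hz (by omega)
    · rw [hgx]
      rcases hz' with hz' | hz'
      · exact hf.sorted (2 * R) i z (by omega) (by omega) (by omega) hz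
      · refine (hle (by omega) (by omega)).trans ?_
        rcases hz'.1.eq_or_lt with rfl | hjz
        · exact le_rfl
        · exact hf.sorted (2 * R + 1) j z (by omega) hjz (by omega) hz

theorem MergeInv.take_right {R x i mid j hi : ℕ} (h : MergeInv κ N w f g R x i mid j hi)
    (hf : BlockSorted κ N w f) (hx : x < hi) (hxN : x < N)
    (hle : i < mid → j < hi ∧ j < N ∧ κ (f j) ≤ κ (f i))
    {g' : ℕ → ℕ} (hg : ∀ y < x, g' y = g y) (hgx : g' x = f j) :
    MergeInv κ N w f g' R (x + 1) i mid (j + 1) hi := by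
  have e1 := h.mid_eq
  have e2 := h.hi_eq
  have e3 := h.le_i
  have e4 := h.le_j
  have e5 := h.i_le
  have e6 := h.x_eq
  have e7 := h.j_bound
  have hj : j < hi ∧ j < N := by
    rcases e5.eq_or_lt with hi' | hi'
    · omega
    · exact ⟨(hle hi').1, (hle hi').2.1⟩
  have b1 : 2 * w * R = w * (2 * R) := by ring
  have b2 : w * (2 * R + 1) = w * (2 * R) + w := by ring
  have b3 : w * (2 * R + 1 + 1) = w * (2 * R) + 2 * w := by ring
  refine ⟨e1, e2, by omega, e5, by omega, hj.1, by omega, .inr hj.2, fun y hy => ?_,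
    fun z hz hz' => ?_, h.sorted_succ hx (.inr ⟨le_rfl, hj.1⟩) hj.2 hg hgx,
    fun y hy hyx z hz hz' => ?_⟩
  · rcases Nat.lt_succ_iff_lt_or_eq.1 hy with hy | rfl
    · rw [hg _ hy]; exact h.range y hy
    · rw [hgx]; exact hf.range j hj.2
  · by_cases hzi : z = j
    · exact ⟨x, by omega, by rw [hgx, hzi]⟩
    · obtain ⟨y, hy, hy'⟩ := h.surj z hz (by omega)
      exact ⟨y, by omega, by rw [hg y hy, hy']⟩
  · rcases Nat.lt_succ_iff_lt_or_eq.1 hyx with hyx | rfl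
    · rw [hg _ hyx]; exact h.below y hy hyx z hz (by omega)
    · rw [hgx]
      rcases hz' with hz' | hz'
      · refine (hle (by omega)).2.2.trans ?_
        rcases hz'.1.eq_or_lt with rfl | hiz
        · exact le_rfl
        · exact hf.sorted (2 * R) i z (by omega) hiz (by omega) hz
      · exact hf.sorted (2 * R + 1) j z (by omega) (by omega) (by omega) hz

theorem MergeInv.blockSorted {R i mid j hi : ℕ} (h : MergeInv κ N w f g R N i mid j hi)
    (hf : BlockSorted κ N w f) : BlockSorted κ N (2 * w) g := by
  refine ⟨h.range, fun v hv => ?_, h.sorted⟩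
  obtain ⟨z, hz, rfl⟩ := hf.surj v hv
  have e4 := h.le_j
  have e5 := h.i_le
  have e6 := h.x_eq
  have e7 := h.j_bound
  exact h.surj z hz (by omega)

end Merge

/-! ### Merge sort -/

/-- The key by which an entry `e` is sorted: ties between the values `key e` are broken by the
entries themselves. -/
noncomputable def sortKey (key : ℕ → ℝ) (e : ℕ) : ℝ ×ₗ ℕ := toLex (key e, e)

theorem sortKey_le_iff {key : ℕ → ℝ} {e f : ℕ} :
    sortKey key e ≤ sortKey key f ↔ key e ≤ key f ∧ ¬ (key f ≤ key e ∧ f < e) := by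
  unfold sortKey
  rw [Prod.Lex.toLex_le_toLex]
  simp only
  constructor
  · rintro (h | ⟨h1, h2⟩)
    · exact ⟨h.le, fun h' => absurd h (not_lt.2 h'.1)⟩
    · exact ⟨h1.le, fun h' => absurd h2 (not_le.2 h'.2)⟩
  · rintro ⟨h1, h2⟩
    rcases h1.lt_or_eq with h | h
    · exact .inl h
    · exact .inr ⟨h, not_lt.1 fun h' => h2 ⟨h.ge, h'⟩⟩

/-- The test whether `e` is at most `f` in the order by which entries are sorted. -/
def leTest (e f : IExp) : Test :=
  .and (.rle (.cell 2 e) (.cell 2 f)) (.neg (.and (.rle (.cell 2 f) (.cell 2 e)) (.ilt f e)))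

@[simp] theorem leTest_holds (s : State) (e f : IExp) :
    (leTest e f).holds s ↔ sortKey (s.rarr 2) (e.eval s) ≤ sortKey (s.rarr 2) (f.eval s) := by
  simp [leTest, sortKey_le_iff]

/-- Merge the blocks of the array 0 at offset `o` into longer blocks at offset `o + N`, where `N`,
`o` and the length of the blocks are in the variables 5, 10, 11. Entries are compared by their
keys in the real array 2, and then by themselves. -/
def mergeProg : Prog :=
  .setI 12 (.lit 0) ;; .setI 13 (.lit 0) ;; .setI 14 (.var 11) ;; .setI 15 (.var 11) ;;
  .setI 16 (.var 11 + .var 11) ;;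
  .loop (.ilt (.var 12) (.var 5))
    (.branch (.and (.ilt (.var 13) (.var 14)) (.neg (.and (.ilt (.var 15) (.var 16))
        (.and (.ilt (.var 15) (.var 5))
          (.neg (leTest (.cell 0 (.var 10 + .var 13)) (.cell 0 (.var 10 + .var 15))))))))
       (.storeI 0 (.var 10 + .var 5 + .var 12) (.cell 0 (.var 10 + .var 13)) ;;
        .setI 13 (.var 13 + .lit 1))
       (.storeI 0 (.var 10 + .var 5 + .var 12) (.cell 0 (.var 10 + .var 15)) ;;
        .setI 15 (.var 15 + .lit 1)) ;;
     .setI 12 (.var 12 + .lit 1) ;;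
     .branch (.ile (.var 16) (.var 12))
       (.setI 13 (.var 16) ;; .setI 14 (.var 16 + .var 11) ;; .setI 15 (.var 16 + .var 11) ;;
        .setI 16 (.var 16 + (.var 11 + .var 11)))
       (.skip 13))

theorem runs_mergeProg {s : State} (hw : 0 < s.ivar 11)
    (hf : BlockSorted (sortKey (s.rarr 2)) (s.ivar 5) (s.ivar 11) fun x => s.iarr 0 (s.ivar 10 + x)) :
    Runs mergeProg s (200 * s.ivar 5 + 100) fun s' =>
      BlockSorted (sortKey (s.rarr 2)) (s.ivar 5) (2 * s.ivar 11)
        fun x => s'.iarr 0 (s.ivar 10 + s.ivar 5 + x) := by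
  obtain ⟨N, hN⟩ : ∃ N, s.ivar 5 = N := ⟨_, rfl⟩
  obtain ⟨o, ho⟩ : ∃ o, s.ivar 10 = o := ⟨_, rfl⟩
  obtain ⟨w, hw'⟩ : ∃ w, s.ivar 11 = w := ⟨_, rfl⟩
  obtain ⟨key, hkey⟩ : ∃ key, s.rarr 2 = key := ⟨_, rfl⟩
  rw [hN, ho, hw', hkey] at hf ⊢
  rw [hw'] at hw
  refine .loopFree_seq (by simp) (.loopFree_seq (by simp) (.loopFree_seq (by simp)
    (.loopFree_seq (by simp) (.loopFree_seq (by simp)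
    (T := 200 * N + 50) ?_ le_rfl) le_rfl) le_rfl) le_rfl) (by simp; omega)
  refine Runs.count N 150 (fun x s' => s'.ivar 12 = x ∧ x < s'.ivar 16 ∧
      (∀ z < o + N, s'.iarr 0 z = s.iarr 0 z) ∧
      ∃ R, MergeInv (sortKey key) N w (fun x => s.iarr 0 (o + x)) (fun x => s'.iarr 0 (o + N + x))
        R x (s'.ivar 13) (s'.ivar 14) (s'.ivar 15) (s'.ivar 16))
    [12, 13, 14, 15, 16] [0] ?_ ?_ ?_ ?_ ?_ ?_
  · simp
  · simp [hw', hw]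
    refine ⟨0, ?_⟩
    rw [← two_mul]
    exact mergeInv_zero
  · rintro x s' - hs ⟨hx, -⟩
    simp [hx, hs.ivar 5, hN]
  · rintro x s' hxN hs ⟨hx, hxhi, h1, R, h⟩
    have f5 := hs.ivar 5
    have f10 := hs.ivar 10
    have f11 := hs.ivar 11
    have gr := hs.rarr
    simp [hN, ho, hw'] at f5 f10 f11 gr
    have gk : s'.rarr 2 = key := by rw [gr, hkey]
    obtain ⟨i, hi⟩ : ∃ i, s'.ivar 13 = i := ⟨_, rfl⟩
    obtain ⟨mid, hmid⟩ : ∃ i, s'.ivar 14 = i := ⟨_, rfl⟩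
    obtain ⟨j, hj⟩ : ∃ i, s'.ivar 15 = i := ⟨_, rfl⟩
    obtain ⟨hh, hhi⟩ : ∃ i, s'.ivar 16 = i := ⟨_, rfl⟩
    rw [hi, hmid, hj, hhi] at h
    rw [hhi] at hxhi
    -- The invariant after the write, before a new block may be begun.
    refine Runs.mono (T := 100 + 50) (Runs.seq (Q := fun s'' => s''.ivar 12 = x ∧
      s''.ivar 14 = mid ∧ s''.ivar 16 = hh ∧ s''.ivar 11 = w ∧
      (∀ z < o + N, s''.iarr 0 z = s.iarr 0 z) ∧
      MergeInv (sortKey key) N w (fun x => s.iarr 0 (o + x)) (fun x => s''.iarr 0 (o + N + x))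
        R (x + 1) (s''.ivar 13) mid (s''.ivar 15) hh)
      (.branch 20 (fun hc => .of_loopFree (by simp) (by simp) ?_)
        (fun hc => .of_loopFree (by simp) (by simp) ?_) ?_)
        fun s'' hs'' => .of_loopFree (by simp) (by simp) ?_)
      (by omega) fun _ h => h
    · have e1 : s'.iarr 0 (o + i) = s.iarr 0 (o + i) := h1 _ (by
        have := h.x_eq; have := h.le_j; omega)
      have e2 : j < N → s'.iarr 0 (o + j) = s.iarr 0 (o + j) := fun _ => h1 _ (by omega)
      simp only [Test.holds_and, Test.holds_neg, Test.holds_ile, leTest_holds, IExp.eval_add,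
        IExp.eval_var, IExp.eval_cell, hi, hj, hmid, hhi, f5, f10, e1, gk, not_le] at hc
      simp [hx, hi, hmid, hj, hhi, f5, f10, f11, e1]
      refine ⟨fun z hz => ?_, h.take_left hf hxhi hxN hc.1 ?_ ?_ ?_⟩
      · rw [if_neg (by omega), h1 z hz]
      · intro h3 h4
        have := hc.2
        rw [e2 h4] at this
        exact not_lt.1 fun h' => this ⟨h3, h4, h'⟩
      · intro y hy
        rw [if_neg hy.ne]
      · simp
    · have e1 : i < mid → s'.iarr 0 (o + i) = s.iarr 0 (o + i) := fun _ => h1 _ (by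
        have := h.x_eq; have := h.le_j; omega)
      have e2 : j < N → s'.iarr 0 (o + j) = s.iarr 0 (o + j) := fun _ => h1 _ (by omega)
      simp only [Test.holds_and, Test.holds_neg, Test.holds_ile, leTest_holds, IExp.eval_add,
        IExp.eval_var, IExp.eval_cell, hi, hj, hmid, hhi, f5, f10, gk, not_le] at hc
      simp [hx, hi, hmid, hj, hhi, f5, f10, f11]
      have hjN : j < N := by
        by_contra hcon
        have := h.x_eq
        have := h.j_bound
        have := h.i_le
        exact hc ⟨by omega, fun h' => absurd h'.2.1 hcon⟩
      rw [e2 hjN]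
      refine ⟨fun z hz => ?_, h.take_right hf hxhi hxN (fun h3 => ?_) ?_ ?_⟩
      · rw [if_neg (by omega), h1 z hz]
      · by_contra hcon
        refine hc ⟨h3, fun h' => hcon ⟨h'.1, h'.2.1, ?_⟩⟩
        rw [← e1 h3, ← e2 hjN]
        exact h'.2.2.le
      · intro y hy
        rw [if_neg hy.ne]
      · simp
    · simp [leTest]
    · obtain ⟨g12, g14, g16, g11, g0, h'⟩ := hs''
      by_cases hc : hh ≤ x + 1
      · simp [g12, g16, g11, hc]
        refine ⟨?_, g0, R + 1, ?_⟩
        · have := h'.i_le; have := h'.j_le; have := h'.x_eq; omega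
        · rw [← two_mul]; exact h'.next_block hc
      · simp [g12, g14, g16, hc]
        exact ⟨by omega, g0, R, h'⟩
  · simp; omega
  · rintro s' hs ⟨-, -, -, R, h⟩
    exact h.blockSorted hf


/-- Sort the numbers below `N`, where `N` is in the variable 5. The sorted sequence is stored in
the array 0, at the offset that is left in the variable 10. -/
def sortProg : Prog :=
  .setI 10 (.lit 0) ;; .setI 11 (.lit 1) ;;
  .loop (.ilt (.var 11) (.var 5))
    (mergeProg ;; .setI 10 (.var 10 + .var 5) ;; .setI 11 (.var 11 + .var 11))

theorem runs_sortProg {s : State} (h0 : ∀ x < s.ivar 5, s.iarr 0 x = x) :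
    Runs sortProg s (Nat.clog 2 (s.ivar 5) * (200 * s.ivar 5 + 200) + 50) fun s' =>
      ∃ w, s.ivar 5 ≤ w ∧
        BlockSorted (sortKey (s.rarr 2)) (s.ivar 5) w fun x => s'.iarr 0 (s'.ivar 10 + x) := by
  obtain ⟨N, hN⟩ : ∃ N, s.ivar 5 = N := ⟨_, rfl⟩
  rw [hN] at h0 ⊢
  refine .loopFree_seq (by simp) (.loopFree_seq (by simp)
    (T := Nat.clog 2 N * (200 * N + 200) + 10) ?_ le_rfl) (by simp; omega)
  refine Runs.count (Nat.clog 2 N) (200 * N + 150) (fun k s' => s'.ivar 11 = 2 ^ k ∧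
      BlockSorted (sortKey (s.rarr 2)) N (2 ^ k) fun x => s'.iarr 0 (s'.ivar 10 + x))
    [10, 11, 12, 13, 14, 15, 16] [0] ?_ ?_ ?_ ?_ ?_ ?_
  · simp [mergeProg]
  · simp
    exact ⟨fun y hy => by simpa [h0 y hy], fun v hv => ⟨v, hv, h0 v hv⟩,
      fun r y y' h1 h2 h3 _ => by omega⟩
  · rintro k s' - hs ⟨h11, -⟩
    simp [h11, hs.ivar 5, hN, Nat.lt_clog_iff_pow_lt]
  · rintro k s' hk hs ⟨h11, hb⟩
    have f5 : s'.ivar 5 = N := by simp [hs.ivar 5, hN]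
    have fr : s'.rarr = s.rarr := by simp [hs.rarr]
    rw [← f5, ← h11, ← fr] at hb
    refine (((runs_mergeProg (by simp [h11]) hb).frame [12, 13, 14, 15, 16] [0]
      (by simp [mergeProg])).seq (T' := 20) fun s'' hs'' => ?_).mono (Q := fun s'' => _) ?_
      fun _ h => h
    rotate_left
    · simp [f5]
    refine .of_loopFree (by simp) (by simp) ?_
    obtain ⟨hf, hb'⟩ := hs''
    have g5 := hf.ivar 5
    have g10 := hf.ivar 10
    have g11 := hf.ivar 11
    simp [f5, h11] at g5 g10 g11
    rw [fr, f5, h11] at hb'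
    simp [g5, g10, g11]
    refine ⟨by ring, ?_⟩
    rw [pow_succ, mul_comm]
    exact hb'
  · simp
    have := Nat.mul_le_mul_left (Nat.clog 2 N) (show 200 * N + 150 + 4 + 1 ≤ 200 * N + 200 by omega)
    omega
  · rintro s' hs ⟨-, hb⟩
    exact ⟨_, Nat.le_pow_clog (by norm_num) N, hb⟩

/-- A totally sorted sequence of the numbers below `N`, as an increasing bijection. -/
theorem BlockSorted.exists_pos {L : Type*} [LinearOrder L] {κ : ℕ → L} {N w : ℕ} {f : ℕ → ℕ}
    (h : BlockSorted κ N w f) (hw : N ≤ w) (hκ : Function.Injective κ) :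
    ∃ pos : ℕ → ℕ, (∀ v < N, pos v < N ∧ f (pos v) = v) ∧ (∀ x < N, pos (f x) = x) ∧
      ∀ u < N, ∀ v < N, κ u ≤ κ v ↔ pos u ≤ pos v := by
  choose! pos hpos using h.surj
  have hinj : ∀ x < N, pos (f x) = x := by
    -- An injective map of a finite set into itself is surjective.
    have hmaps : Set.MapsTo pos (Finset.range N) (Finset.range N) := fun v hv => by
      simp only [Finset.coe_range, Set.mem_Iio] at *
      exact (hpos v hv).1
    have hpinj : Set.InjOn pos (Finset.range N) := fun u hu v hv huv => by
      simp only [Finset.coe_range, Set.mem_Iio] at *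
      rw [← (hpos u hu).2, ← (hpos v hv).2, huv]
    have hsurj := Finset.surjOn_of_injOn_of_card_le pos hmaps hpinj le_rfl
    intro x hx
    obtain ⟨v, hv, rfl⟩ := hsurj (show x ∈ (Finset.range N : Set ℕ) by simpa using hx)
    rw [(hpos v (by simpa using hv)).2]
  have hle : ∀ u < N, ∀ v < N, pos u ≤ pos v → κ u ≤ κ v := by
    intro u hu v hv huv
    rcases huv.eq_or_lt with huv | huv
    · rw [← (hpos u hu).2, huv, (hpos v hv).2]
    · have := h.sorted 0 (pos u) (pos v) (by simp) huv
        (by have := (hpos v hv).1; simp; omega) (hpos v hv).1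
      rwa [(hpos u hu).2, (hpos v hv).2] at this
  refine ⟨pos, hpos, hinj, fun u hu v hv => ⟨fun huv => ?_, hle u hu v hv⟩⟩
  by_contra! hcon
  have := hκ (huv.antisymm (hle v hv u hu hcon.le))
  rw [this] at hcon
  exact lt_irrefl _ hcon

/-! ### Finding a greedy step -/

section Criterion

variable {n m : ℕ} {F : Fin n → Fin m → Prop} {h g : ℕ → ℕ} {D : ℕ} {p : Fin n} {q : Fin m}
  {y i e : ℕ}

/-- Let the free pairs be given by `h i + g j ≤ D`, and let `D - y` be the largest height of a
vertex of the second curve that is seen from `p`. Then the first later vertex of height at most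
`y` on the first curve is a greedy step, if it is reachable. -/
theorem greedyStep_of_lt (hF : ∀ i j, F i j ↔ h i + g j ≤ D)
    (hmin : ∀ y', h p ≤ y' → y' < y → ∀ k < m, q ≤ k → g k + y' ≠ D)
    (hpi : p < i) (hin : i < n) (hi : h i ≤ y) (hi' : ∀ j : ℕ, p < j → j < i → y < h j)
    (he' : ∀ j : ℕ, p < j → j < e → h j + g q ≤ D) (hie : i < e) :
    GreedyStep F p q ⟨i, hin⟩ := by
  refine ⟨hpi, fun j h1 h2 => ?_, fun j h1 h2 k hk hjk => ?_⟩
  · rw [hF]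
    exact he' j h1 (lt_of_le_of_lt (Fin.le_def.1 h2) hie)
  · rw [hF] at hjk ⊢
    simp only
    rcases h1.eq_or_lt with rfl | h1
    · by_contra hcon
      exact hmin (D - g k) (by omega) (by omega) k k.2 hk (by omega)
    · rcases (Fin.le_def.1 h2).eq_or_lt with h2 | h2
      · simp only at h2
        rwa [h2] at hjk
      · have := hi' j h1 h2
        omega

/-- In the situation of `greedyStep_of_lt`, there is no greedy step if the vertex `i` is not
reachable, because the vertices before `i` see less than `p` does. -/
theorem not_greedyStep_of_le (hF : ∀ i j, F i j ↔ h i + g j ≤ D) (hpy : h p ≤ y)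
    (hk : ∃ k < m, (q : ℕ) ≤ k ∧ g k + y = D) (hi' : ∀ j : ℕ, p < j → j < i → y < h j)
    (hpe : p < e) (he : e < n → D < h e + g q) (hei : e ≤ i) (r : Fin n) :
    ¬ GreedyStep F p q r := by
  rintro ⟨h1, h2, h3⟩
  obtain ⟨k, hkm, hqk, hk⟩ := hk
  by_cases hre : (r : ℕ) < e
  · have hr := (hF _ _).1 (h3 p le_rfl h1.le ⟨k, hkm⟩ hqk ((hF _ _).2 (by simp only; omega)))
    have := hi' r h1 (by omega)
    simp only at hr
    omega
  · have := (hF _ _).1 (h2 ⟨e, by omega⟩ hpe (not_lt.1 hre))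
    have := he (by omega)
    simp only at *
    omega

end Criterion

/-- Three sections of length `S` of the array `K`, from `b` on, that serve the search for greedy
steps on a curve with `n` vertices of heights `h`; the other curve has `m` vertices of heights
`g`. The first section holds the numbers `D - h i` and the second one the heights `h i`, with a
sentinel behind them. The third one inverts `g`: its entry `y` is `k + 1` if `g k = D - y`, and
zero if there is no such `k`. -/
structure Sections (K : ℕ → ℕ) (b S D n m : ℕ) (h g : ℕ → ℕ) : Prop where
  bound : ∀ i < n, h i ≤ D
  low : ∀ i < n, K (b + i) = D - h i
  low_end : K (b + n) = D + 1
  high : ∀ i < n, K (b + S + i) = h i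
  high_end : K (b + S + n) = D + 1
  inv : ∀ y ≤ D, ∀ c, 0 < c → (c ≤ K (b + 2 * S + y) ↔ ∃ k < m, c ≤ k + 1 ∧ g k + y = D)

/-- Put into the variable `d` the first position from `e` on with an entry of at least `f`. -/
def lookupProg (d : ℕ) (e f : IExp) : Prog :=
  .setI 20 e ;; .setI 21 f ;; findProg ;; .setI d (.var 20)

theorem runs_lookupProg {K : ℕ → ℕ} {M r d x c T : ℕ} {e f : IExp} {s : State}
    (ht : TableUpTo K M r s) (hr : s.ivar 9 = r) (hM : M ≤ 2 ^ r)
    (he : e.eval s = x) (hf : f.eval ((Prog.setI 20 e).run s) = c)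
    {Y : ℕ} (hY : x ≤ Y) (hYM : Y < M) (hKY : c ≤ K Y)
    (hT : 40 * r + 20 + e.cost + f.cost ≤ T) :
    Runs (lookupProg d e f) s T fun s' => SameExcept [20, 21, 22, d] [] s s' ∧
      x ≤ s'.ivar d ∧ s'.ivar d ≤ Y ∧ c ≤ K (s'.ivar d) ∧
      ∀ y, x ≤ y → y < s'.ivar d → K y < c := by
  refine Runs.frame _ _ (by simp [lookupProg, findProg]) ?_
  refine .loopFree_seq (by simp) (.loopFree_seq (by simp) (T := 40 * r + 15) ?_ le_rfl)
    (by simp; omega)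
  simp at hf
  refine ((runs_findProg (K := K) (M := M) (r := r) (Y := Y) ⟨?_, ?_, ?_, ?_⟩ ?_ hM ?_ hYM ?_).seq
    (T' := 5) fun s' hs' => .of_loopFree (by simp) (by simp) ?_).mono le_rfl fun _ h => h
  · simpa using ht.base
  · simpa using ht.width
  · simpa using ht.offset
  · simpa using ht.level
  · simpa using hr
  · simpa [he] using hY
  · simpa [hf] using hKY
  · rw [he] at hf
    simp [he, hf] at hs' ⊢
    exact hs'

/-- The data for the search for greedy steps on one of the curves: a table of maxima, and three
sections that begin at the positions in the variables `b`, `b + 1`, `b + 2`. -/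
structure Side (K : ℕ → ℕ) (M r b n m D : ℕ) (h g : ℕ → ℕ) (s : State) : Prop where
  table : TableUpTo K M r s
  levels : s.ivar 9 = r
  le_pow : M ≤ 2 ^ r
  top : s.ivar 6 = D
  secs : ∃ β S, s.ivar b = β ∧ s.ivar (b + 1) = β + S ∧ s.ivar (b + 2) = β + 2 * S ∧
    Sections K β S D n m h g ∧ β + 3 * S ≤ M ∧ n < S ∧ D < S

theorem Side.of_sameExcept {K : ℕ → ℕ} {M r b n m D : ℕ} {h g : ℕ → ℕ} {s s' : State}
    (hs : Side K M r b n m D h g s) {I : List ℕ} (he : SameExcept I [] s s')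
    (hI : ∀ x ∈ [6, 9, b, b + 1, b + 2], x ∉ I) : Side K M r b n m D h g s' := by
  have hi : ∀ x ∈ [6, 9, b, b + 1, b + 2], s'.ivar x = s.ivar x := fun x hx => he.ivar x (hI x hx)
  have ha : s'.iarr = s.iarr := funext fun a => he.iarr a (by simp)
  refine ⟨⟨?_, ?_, ?_, ?_⟩, ?_, hs.le_pow, ?_, ?_⟩
  · rw [ha]; exact hs.table.base
  · rw [ha]; exact hs.table.width
  · rw [ha]; exact hs.table.offset
  · rw [ha]; exact hs.table.level
  · rw [hi 9 (by simp)]; exact hs.levels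
  · rw [hi 6 (by simp)]; exact hs.top
  · rw [hi b (by simp), hi (b + 1) (by simp), hi (b + 2) (by simp)]; exact hs.secs

/-- Search for a greedy step on one of the curves, where `p` is the variable for the index on this
curve and `q` the one for the other curve. If a step is found, then `p` is updated and the
variable 4 is set to 1. -/
def stepProg (b b' p q : ℕ) : Prog :=
  lookupProg 23 (.var (b + 2) + .cell 1 (.var (b + 1) + .var p)) (.var q + .lit 1) ;;
  lookupProg 24 (.var b + (.var p + .lit 1)) (.var 6 - (.var 23 - .var (b + 2))) ;;
  lookupProg 25 (.var (b + 1) + (.var p + .lit 1))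
    (.var 6 + .lit 1 - .cell 1 (.var (b' + 1) + .var q)) ;;
  .branch (.ilt (.var 24 - .var b) (.var 25 - .var (b + 1)))
    (.setI p (.var 24 - .var b) ;; .setI 4 (.lit 1)) (.skip p)

set_option maxHeartbeats 800000 in
/-- `stepProg` finds a greedy step if there is one, with three searches of logarithmic time. -/
theorem runs_stepProg {K : ℕ → ℕ} {M r b b' p q n m D : ℕ} {h g : ℕ → ℕ} {s : State}
    (hb : 30 ≤ b) (hb' : 30 ≤ b') (hp : p < 4) (hq : q < 4)
    (hs : Side K M r b n m D h g s) (hs' : Side K M r b' m n D g h s)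
    {F : Fin n → Fin m → Prop} (hF : ∀ i j, F i j ↔ h i + g j ≤ D)
    {P : Fin n} {Q : Fin m} (hP : s.ivar p = P) (hQ : s.ivar q = Q) (hPQ : F P Q) :
    Runs (stepProg b b' p q) s (120 * r + 200) fun s' =>
      SameExcept [p, 4, 20, 21, 22, 23, 24, 25] [] s s' ∧
      ((∃ R : Fin n, GreedyStep F P Q R ∧ s'.ivar p = R ∧ s'.ivar 4 = 1) ∨
        ((∀ R, ¬ GreedyStep F P Q R) ∧ s'.ivar p = P ∧ s'.ivar 4 = s.ivar 4)) := by
  refine Runs.frame _ _ (by simp [stepProg, lookupProg, findProg]) ?_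
  obtain ⟨β, S, r0, r1, r2, sec, hM, hnS, hDS⟩ := hs.secs
  obtain ⟨β', S', r0', r1', r2', sec', hM', hnS', hDS'⟩ := hs'.secs
  have hPn := P.2
  have hQm := Q.2
  have e1 : s.iarr 1 (β + S + P) = h P := by
    rw [hs.table.base _ (by omega), sec.high _ hPn]
  have e1' : s.iarr 1 (β' + S' + Q) = g Q := by
    rw [hs.table.base _ (by omega), sec'.high _ hQm]
  have hfree := (hF _ _).1 hPQ
  have hgQ := sec'.bound _ hQm
  have hhP := sec.bound _ hPn
  -- The first search determines the largest height on the other curve that is seen.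
  refine ((runs_lookupProg hs.table hs.levels hs.le_pow (x := β + 2 * S + h P) (c := Q + 1)
    (Y := β + 2 * S + (D - g Q)) (by simp [r2, r1, hP, e1])
    (by simp [show q ≠ 20 by omega, hQ]) (by omega) (by omega)
    ((sec.inv _ (by omega) _ (by omega)).2 ⟨Q, hQm, le_rfl, by omega⟩)
    (T := 40 * r + 40) (by simp)).seq (T' := 80 * r + 160) ?_).mono (by omega) fun _ h => h
  rintro s1 ⟨fr1, y1, y2, y3, y4⟩
  obtain ⟨y, hy⟩ : ∃ y, s1.ivar 23 = β + 2 * S + y := ⟨s1.ivar 23 - (β + 2 * S), by omega⟩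
  rw [hy] at y1 y2 y3 y4
  rw [sec.inv y (by omega) _ (by omega)] at y3
  have hyD : y ≤ D := by omega
  have hmin : ∀ y', h P ≤ y' → y' < y → ∀ k < m, (Q : ℕ) ≤ k → g k + y' ≠ D := by
    intro y' h1 h2 k hk hQk hkD
    have := y4 (β + 2 * S + y') (by omega) (by omega)
    rw [← not_le, sec.inv y' (by omega) _ (by omega)] at this
    exact this ⟨k, hk, by omega, hkD⟩
  have hs1 := hs.of_sameExcept fr1 (by simp; omega)
  have a0 := fr1.ivar b (by simp; omega)
  have a1 := fr1.ivar (b + 1) (by simp; omega)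
  have a2 := fr1.ivar (b + 2) (by simp; omega)
  have ap := fr1.ivar p (by simp; omega)
  have aq := fr1.ivar q (by simp; omega)
  have a1' := fr1.ivar (b' + 1) (by simp; omega)
  have a4 := fr1.ivar 4 (by simp)
  have aa := fr1.iarr 1 (by simp)
  -- The second search determines the candidate.
  refine ((runs_lookupProg hs1.table hs1.levels hs1.le_pow (x := β + (P + 1)) (c := D - y)
    (Y := β + n) (by simp [a0, r0, ap, hP])
    (by simp [show b + 2 ≠ 20 by omega, hy, a2, r2, hs1.top]) (by omega) (by omega)
    (by rw [sec.low_end]; omega)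
    (T := 40 * r + 40) (by simp)).seq (T' := 40 * r + 120) ?_).mono (by omega) fun _ h => h
  rintro s2 ⟨fr2, i1, i2, i3, i4⟩
  obtain ⟨i, hi⟩ : ∃ i, s2.ivar 24 = β + i := ⟨s2.ivar 24 - β, by omega⟩
  rw [hi] at i1 i2 i3 i4
  have hs2 := hs1.of_sameExcept fr2 (by simp; omega)
  have b0 := fr2.ivar b (by simp; omega)
  have b1 := fr2.ivar (b + 1) (by simp; omega)
  have bp := fr2.ivar p (by simp; omega)
  have bq := fr2.ivar q (by simp; omega)
  have b1' := fr2.ivar (b' + 1) (by simp; omega)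
  have b4 := fr2.ivar 4 (by simp)
  have ba := fr2.iarr 1 (by simp)
  have hi' : ∀ j, (P : ℕ) < j → j < i → y < h j := by
    intro j h1 h2
    have := i4 (β + j) (by omega) (by omega)
    rw [sec.low j (by omega)] at this
    omega
  -- The third search determines the first vertex that is not seen.
  refine ((runs_lookupProg hs2.table hs2.levels hs2.le_pow (x := β + S + (P + 1))
    (c := D + 1 - g Q) (Y := β + S + n) (by simp [b1, a1, r1, bp, ap, hP])
    (by simp [show b' + 1 ≠ 20 by omega, show q ≠ 20 by omega, b1', a1', r1', bq, aq, hQ, ba, aa,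
      e1', hs2.top]) (by omega) (by omega)
    (by rw [sec.high_end]; omega)
    (T := 40 * r + 50) (by simp)).seq (T' := 50) ?_).mono (by omega) fun _ h => h
  rintro s3 ⟨fr3, t1, t2, t3, t4⟩
  obtain ⟨e, he⟩ : ∃ e, s3.ivar 25 = β + S + e := ⟨s3.ivar 25 - (β + S), by omega⟩
  rw [he] at t1 t2 t3 t4
  have c24 := fr3.ivar 24 (by simp)
  have c0 := fr3.ivar b (by simp; omega)
  have c1 := fr3.ivar (b + 1) (by simp; omega)
  have cp := fr3.ivar p (by simp; omega)
  have c4 := fr3.ivar 4 (by simp)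
  have he1 : ∀ j, (P : ℕ) < j → j < e → h j + g Q ≤ D := by
    intro j h1 h2
    have := t4 (β + S + j) (by omega) (by omega)
    rw [sec.high j (by omega)] at this
    omega
  have he2 : e < n → D < h e + g Q := by
    intro h1
    rw [sec.high e h1] at t3
    omega
  rw [hi] at c24
  rw [b0, a0, r0] at c0
  rw [b1, a1, r1] at c1
  refine .branch 20 (fun hc => .of_loopFree (by simp) (by simp) ?_)
    (fun hc => .of_loopFree (by simp) (by simp) ?_) (by simp)
  · simp [c24, c0, c1, he] at hc
    have hin : i < n := by omega
    rw [sec.low i hin] at i3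
    have := sec.bound i hin
    refine .inl ⟨⟨i, hin⟩, greedyStep_of_lt hF hmin (by omega) hin (by omega) hi' he1 hc, ?_⟩
    simp [c24, c0, show p ≠ 4 by omega]
  · simp [c24, c0, c1, he] at hc
    obtain ⟨k, hk1, hk2, hk3⟩ := y3
    refine .inr ⟨not_greedyStep_of_le hF (by omega) ⟨k, hk1, by omega, hk3⟩ hi' (by omega) he2 hc,
      ?_⟩
    simp [cp, bp, ap, hP, c4, b4, a4, show 4 ≠ p by omega]

/-! ### Preprocessing -/

/-- Store `n + m` in the variable 5, the numbers below `n + m` in the array 0, and their keys in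
the real array 2: the numbers `j < m` stand for the vertices of `σ` and have keys `-σ_j`, and the
numbers `m + i` stand for the vertices of `π` and have keys `δ - π_i`. -/
def keysProg : Prog :=
  .setI 5 (.var 0 + .var 1) ;; .setI 12 (.lit 0) ;;
  .loop (.ilt (.var 12) (.var 5))
    (.storeI 0 (.var 12) (.var 12) ;;
     .branch (.ilt (.var 12) (.var 1)) (.storeR 2 (.var 12) (.var 1 - .cell 1 (.var 12)))
       (.storeR 2 (.var 12) (.var 0 - .cell 0 (.var 12 - .var 1))) ;;
     .setI 12 (.var 12 + .lit 1))

theorem runs_keysProg {n m : ℕ} (π : Fin n → ℝ) (σ : Fin m → ℝ) (δ : ℝ) :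
    Runs keysProg (inputState π σ δ) (50 * (n + m) + 50) fun s =>
      (s.ivar 0 = n ∧ s.ivar 1 = m ∧ s.ivar 5 = n + m ∧ s.iarr 1 = (fun _ => 0) ∧ s.out = []) ∧
      (∀ x < n + m, s.iarr 0 x = x) ∧ (∀ j : Fin m, s.rarr 2 j = - σ j) ∧
      ∀ i : Fin n, s.rarr 2 (m + i) = δ - π i := by
  refine .loopFree_seq (by simp) (.loopFree_seq (by simp) (T := 50 * (n + m) + 20) ?_ le_rfl)
    (by simp; omega)
  refine (Runs.loop (T := 40) (fun k s => ∃ x, k + x = n + m ∧ s.ivar 12 = x ∧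
      (s.ivar 0 = n ∧ s.ivar 1 = m ∧ s.ivar 5 = n + m ∧ s.iarr 1 = (fun _ => 0) ∧ s.out = []) ∧
      s.rvar = (inputState π σ δ).rvar ∧ s.rarr 0 = (inputState π σ δ).rarr 0 ∧
      s.rarr 1 = (inputState π σ δ).rarr 1 ∧
      (∀ y < x, s.iarr 0 y = y) ∧ (∀ j : Fin m, (j : ℕ) < x → s.rarr 2 j = - σ j) ∧
      ∀ i : Fin n, m + (i : ℕ) < x → s.rarr 2 (m + i) = δ - π i) ?_ (n + m) _ ⟨0, ?_⟩).mono ?_ ?_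
  · rintro k s ⟨x, hkx, h12, ⟨h0, h1, h5, hz, ho⟩, hrv, hr0, hr1, hid, hσ, hπ⟩ hc
    simp [h12, h5] at hc
    refine .of_loopFree (by simp) (by simp) ⟨k - 1, by omega, x + 1, by omega, ?_⟩
    have hrv0 : s.rvar 0 = δ := by rw [hrv]; simp [inputState]
    have hrv1 : s.rvar 1 = 0 := by rw [hrv]; simp [inputState]
    by_cases hx : x < m
    · have hcell : s.rarr 1 x = σ ⟨x, hx⟩ := by rw [hr1]; simp [inputState, hx]
      rw [hrv] at hrv1
      simp [h12, h0, h1, h5, hx, hrv1, hcell, ho, hrv, hr0, hr1, hz]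
      refine ⟨fun y hy => ?_, fun j hj => ?_, fun i hi => by omega⟩
      · split_ifs with h
        · exact h.symm
        · exact hid y (by omega)
      · split_ifs with h
        · simp [← h]
        · exact hσ j (by omega)
    · have hcell : s.rarr 0 (x - m) = π ⟨x - m, by omega⟩ := by
        rw [hr0]; simp [inputState, show x - m < n by omega]
      rw [hrv] at hrv0
      simp [h12, h0, h1, h5, hx, hrv0, hcell, ho, hrv, hr0, hr1, hz]
      refine ⟨fun y hy => ?_, fun j hj => ?_, fun i hi => ?_⟩
      · split_ifs with h
        · exact h.symm
        · exact hid y (by omega)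
      · rw [if_neg (by omega)]
        exact hσ j (by omega)
      · split_ifs with h
        · simp [← h]
        · exact hπ i (by omega)
  · simp [inputState]
  · simp
    omega
  · rintro s ⟨⟨k, x, hkx, h12, h, -, -, -, hid, hσ, hπ⟩, hc⟩
    simp [h12, h.2.2.1] at hc
    exact ⟨h, fun y hy => hid y (by omega), fun j => hσ j (by omega), fun i => hπ i (by omega)⟩

/-- Compute the sections of `Sections` for both curves, in the array 1, and the variables that
describe them. The sorted sequence of vertices is read from the array 0, at the offset that is in
the variable 10. -/
def sectionsProg : Prog :=
  .setI 6 (.var 5 - .lit 1) ;; .setI 30 (.lit 0) ;; .setI 31 (.var 5 + .lit 1) ;;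
  .setI 32 (.var 31 + .var 31) ;; .setI 33 (.var 32 + .var 31) ;; .setI 34 (.var 33 + .var 31) ;;
  .setI 35 (.var 34 + .var 31) ;; .setI 8 (.var 35 + .var 31) ;; .setI 12 (.lit 0) ;;
  .loop (.ilt (.var 12) (.var 5))
    (.setI 13 (.cell 0 (.var 10 + .var 12)) ;;
     .branch (.ilt (.var 13) (.var 1))
       (.storeI 1 (.var 33 + .var 13) (.var 6 - .var 12) ;;
        .storeI 1 (.var 34 + .var 13) (.var 12) ;;
        .storeI 1 (.var 32 + (.var 6 - .var 12)) (.var 13 + .lit 1))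
       (.storeI 1 (.var 13 - .var 1) (.var 12) ;;
        .storeI 1 (.var 31 + (.var 13 - .var 1)) (.var 6 - .var 12) ;;
        .storeI 1 (.var 35 + .var 12) (.var 13 - .var 1 + .lit 1)) ;;
     .setI 12 (.var 12 + .lit 1)) ;;
  .storeI 1 (.var 0) (.var 5) ;; .storeI 1 (.var 31 + .var 0) (.var 5) ;;
  .storeI 1 (.var 33 + .var 1) (.var 5) ;; .storeI 1 (.var 34 + .var 1) (.var 5)

/-- What the first `x` iterations of the loop of `sectionsProg` have stored in the array 1. -/
structure SectionsUpTo (f : ℕ → ℕ) (D S n m x : ℕ) (K : ℕ → ℕ) : Prop where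
  second : ∀ y < x, f y < m → K (3 * S + f y) = D - y ∧ K (4 * S + f y) = y ∧
    K (2 * S + (D - y)) = f y + 1 ∧ K (5 * S + y) = 0
  first : ∀ y < x, m ≤ f y → K (f y - m) = y ∧ K (S + (f y - m)) = D - y ∧
    K (5 * S + y) = f y - m + 1 ∧ K (2 * S + (D - y)) = 0
  rest : ∀ y < n + m, x ≤ y → K (5 * S + y) = 0 ∧ K (2 * S + (D - y)) = 0

/-- The three writes of one iteration of the loop of `sectionsProg`, for a vertex of the second
curve. -/
theorem SectionsUpTo.succ_second {f : ℕ → ℕ} {D S n m x : ℕ} {K K' : ℕ → ℕ}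
    (h : SectionsUpTo f D S n m x K) (hS : S = n + m + 1) (hD : D + 1 = n + m) (hx : x < n + m)
    (hf : ∀ y ≤ x, f y < n + m) (hne : ∀ y < x, f y ≠ f x) (hm : f x < m)
    (hK : ∀ z, K' z = if z = 2 * S + (D - x) then f x + 1 else if z = 4 * S + f x then x else
      if z = 3 * S + f x then D - x else K z) : SectionsUpTo f D S n m (x + 1) K' := by
  have keep : ∀ z, z ≠ 2 * S + (D - x) → z ≠ 4 * S + f x → z ≠ 3 * S + f x → K' z = K z :=
    fun z h1 h2 h3 => by rw [hK, if_neg h1, if_neg h2, if_neg h3]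
  refine ⟨fun y hy hy' => ?_, fun y hy hy' => ?_, fun y hy hxy => ?_⟩
  · rcases Nat.lt_succ_iff_lt_or_eq.1 hy with hy | rfl
    · have := hne y hy
      rw [keep _ (by omega) (by omega) (by omega), keep _ (by omega) (by omega) (by omega),
        keep _ (by omega) (by omega) (by omega), keep _ (by omega) (by omega) (by omega)]
      exact h.second y hy hy'
    · refine ⟨?_, ?_, ?_, ?_⟩
      · rw [hK, if_neg (by omega), if_neg (by omega), if_pos rfl]
      · rw [hK, if_neg (by omega), if_pos rfl]
      · rw [hK, if_pos rfl]
      · rw [keep _ (by omega) (by omega) (by omega)]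
        exact (h.rest y hx le_rfl).1
  · rcases Nat.lt_succ_iff_lt_or_eq.1 hy with hy | rfl
    · have := hf y (by omega)
      rw [keep _ (by omega) (by omega) (by omega), keep _ (by omega) (by omega) (by omega),
        keep _ (by omega) (by omega) (by omega), keep _ (by omega) (by omega) (by omega)]
      exact h.first y hy hy'
    · omega
  · rw [keep _ (by omega) (by omega) (by omega), keep _ (by omega) (by omega) (by omega)]
    exact h.rest y hy (by omega)

/-- The three writes of one iteration of the loop of `sectionsProg`, for a vertex of the first
curve. -/
theorem SectionsUpTo.succ_first {f : ℕ → ℕ} {D S n m x : ℕ} {K K' : ℕ → ℕ}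
    (h : SectionsUpTo f D S n m x K) (hS : S = n + m + 1) (hD : D + 1 = n + m) (hx : x < n + m)
    (hf : ∀ y ≤ x, f y < n + m) (hne : ∀ y < x, f y ≠ f x) (hm : m ≤ f x)
    (hK : ∀ z, K' z = if z = 5 * S + x then f x - m + 1 else if z = S + (f x - m) then D - x else
      if z = f x - m then x else K z) : SectionsUpTo f D S n m (x + 1) K' := by
  have keep : ∀ z, z ≠ 5 * S + x → z ≠ S + (f x - m) → z ≠ f x - m → K' z = K z :=
    fun z h1 h2 h3 => by rw [hK, if_neg h1, if_neg h2, if_neg h3]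
  have hfx := hf x le_rfl
  refine ⟨fun y hy hy' => ?_, fun y hy hy' => ?_, fun y hy hxy => ?_⟩
  · rcases Nat.lt_succ_iff_lt_or_eq.1 hy with hy | rfl
    · rw [keep _ (by omega) (by omega) (by omega), keep _ (by omega) (by omega) (by omega),
        keep _ (by omega) (by omega) (by omega), keep _ (by omega) (by omega) (by omega)]
      exact h.second y hy hy'
    · omega
  · rcases Nat.lt_succ_iff_lt_or_eq.1 hy with hy | rfl
    · have := hne y hy
      have := hf y (by omega)
      rw [keep _ (by omega) (by omega) (by omega), keep _ (by omega) (by omega) (by omega),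
        keep _ (by omega) (by omega) (by omega), keep _ (by omega) (by omega) (by omega)]
      exact h.first y hy hy'
    · refine ⟨?_, ?_, ?_, ?_⟩
      · rw [hK, if_neg (by omega), if_neg (by omega), if_pos rfl]
      · rw [hK, if_neg (by omega), if_pos rfl]
      · rw [hK, if_pos rfl]
      · rw [keep _ (by omega) (by omega) (by omega)]
        exact (h.rest y hx le_rfl).2
  · rw [keep _ (by omega) (by omega) (by omega), keep _ (by omega) (by omega) (by omega)]
    exact h.rest y hy (by omega)

/-- Adding the sentinels completes the sections of both curves. -/
theorem SectionsUpTo.sections {f pos : ℕ → ℕ} {D S n m : ℕ} {K K' : ℕ → ℕ}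
    (h : SectionsUpTo f D S n m (n + m) K) (hS : S = n + m + 1) (hD : D + 1 = n + m)
    (hpos : ∀ v < n + m, pos v < n + m ∧ f (pos v) = v) (hpf : ∀ x < n + m, pos (f x) = x)
    (hfN : ∀ x < n + m, f x < n + m)
    (hK : ∀ z, K' z = if z = 4 * S + m then n + m else if z = 3 * S + m then n + m else
      if z = S + n then n + m else if z = n then n + m else K z) :
    Sections K' 0 S D n m (fun i => D - pos (m + i)) pos ∧
      Sections K' (3 * S) S D m n pos (fun i => D - pos (m + i)) := by
  have keep : ∀ z, z ≠ 4 * S + m → z ≠ 3 * S + m → z ≠ S + n → z ≠ n → K' z = K z :=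
    fun z h1 h2 h3 h4 => by rw [hK, if_neg h1, if_neg h2, if_neg h3, if_neg h4]
  have hA : ∀ i < n, K (i) = pos (m + i) ∧ K (S + i) = D - pos (m + i) ∧
      pos (m + i) < n + m := by
    intro i hi
    obtain ⟨h1, h2⟩ := hpos (m + i) (by omega)
    have := h.first _ h1 (by omega)
    rw [h2, Nat.add_sub_cancel_left] at this
    exact ⟨this.1, this.2.1, h1⟩
  have hB : ∀ j < m, K (3 * S + j) = D - pos j ∧ K (4 * S + j) = pos j ∧ pos j < n + m := by
    intro j hj
    obtain ⟨h1, h2⟩ := hpos j (by omega)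
    have := h.second _ h1 (by omega)
    rw [h2] at this
    exact ⟨this.1, this.2.1, h1⟩
  constructor
  · refine ⟨fun i hi => Nat.sub_le _ _, fun i hi => ?_, ?_, fun i hi => ?_, ?_,
      fun y hy c hc => ?_⟩
    · obtain ⟨h1, h2, h3⟩ := hA i hi
      rw [keep _ (by omega) (by omega) (by omega) (by omega), zero_add, h1]
      omega
    · rw [hK, if_neg (by omega), if_neg (by omega), if_neg (by omega), if_pos (by omega), hD]
    · rw [keep _ (by omega) (by omega) (by omega) (by omega), zero_add, (hA i hi).2.1]
    · rw [hK, if_neg (by omega), if_neg (by omega), if_pos (by omega), hD]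
    · rw [keep _ (by omega) (by omega) (by omega) (by omega), zero_add]
      have hpx := hpf (D - y) (by omega)
      have hDy : D - (D - y) = y := by omega
      by_cases hx : f (D - y) < m
      · have := (h.second (D - y) (by omega) hx).2.2.1
        rw [hDy] at this
        rw [this]
        constructor
        · intro hc'
          exact ⟨_, hx, hc', by omega⟩
        · rintro ⟨k, hk, hck, hky⟩
          rw [show D - y = pos k by omega, (hpos k (by omega)).2]
          exact hck
      · have := (h.first (D - y) (by omega) (by omega)).2.2.2
        rw [hDy] at this
        rw [this]
        constructor
        · intro hc'; omega
        · rintro ⟨k, hk, hck, hky⟩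
          rw [show D - y = pos k by omega, (hpos k (by omega)).2] at hx
          omega
  · refine ⟨fun i hi => ?_, fun i hi => ?_, ?_, fun i hi => ?_, ?_, fun y hy c hc => ?_⟩
    · have := (hB i hi).2.2
      omega
    · rw [keep _ (by omega) (by omega) (by omega) (by omega), (hB i hi).1]
    · rw [hK, if_neg (by omega), if_pos rfl, hD]
    · rw [keep _ (by omega) (by omega) (by omega) (by omega),
        show 3 * S + S + i = 4 * S + i by omega, (hB i hi).2.1]
    · rw [hK, if_pos (by omega), hD]
    · rw [keep _ (by omega) (by omega) (by omega) (by omega),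
        show 3 * S + 2 * S + y = 5 * S + y by omega]
      have hpx := hpf y (by omega)
      have hfy := hfN y (by omega)
      by_cases hx : f y < m
      · rw [(h.second y (by omega) hx).2.2.2]
        constructor
        · intro hc'; omega
        · rintro ⟨k, hk, hck, hky⟩
          have := (hpos (m + k) (by omega))
          rw [show pos (m + k) = y by omega] at this
          omega
      · rw [(h.first y (by omega) (by omega)).2.2.1]
        constructor
        · intro hc'
          refine ⟨_, by omega, hc', ?_⟩
          rw [Nat.add_sub_cancel' (by omega), hpx]
          omega
        · rintro ⟨k, hk, hck, hky⟩
          have := (hpos (m + k) (by omega))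
          rw [show pos (m + k) = y by omega] at this
          omega

theorem runs_sectionsProg {n m D : ℕ} {s : State} (hD : D + 1 = n + m)
    (h0 : s.ivar 0 = n) (h1 : s.ivar 1 = m) (h5 : s.ivar 5 = n + m)
    (hz : s.iarr 1 = fun _ => 0) {f pos : ℕ → ℕ} (hf : ∀ x < n + m, s.iarr 0 (s.ivar 10 + x) = f x)
    (hpos : ∀ v < n + m, pos v < n + m ∧ f (pos v) = v) (hpf : ∀ x < n + m, pos (f x) = x)
    (hfN : ∀ x < n + m, f x < n + m) :
    Runs sectionsProg s (80 * (n + m) + 100) fun s' =>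
      s'.ivar 6 = D ∧ s'.ivar 8 = 6 * (n + m + 1) ∧ (∀ k < 6, s'.ivar (30 + k) = k * (n + m + 1)) ∧
      Sections (s'.iarr 1) 0 (n + m + 1) D n m (fun i => D - pos (m + i)) pos ∧
      Sections (s'.iarr 1) (3 * (n + m + 1)) (n + m + 1) D m n pos (fun i => D - pos (m + i)) := by
  obtain ⟨S, hS⟩ : ∃ S, S = n + m + 1 := ⟨_, rfl⟩
  rw [← hS]
  refine .loopFree_seq (by simp) (.loopFree_seq (by simp) (.loopFree_seq (by simp)
    (.loopFree_seq (by simp) (.loopFree_seq (by simp) (.loopFree_seq (by simp)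
    (.loopFree_seq (by simp) (.loopFree_seq (by simp) (.loopFree_seq (by simp)
    (T := 80 * (n + m) + 20 + 30) ?_ le_rfl) le_rfl) le_rfl) le_rfl) le_rfl) le_rfl) le_rfl) le_rfl)
    (by simp; omega)
  refine .seq (Q := fun s' => (s'.ivar 0 = n ∧ s'.ivar 1 = m ∧ s'.ivar 5 = n + m ∧
      s'.ivar 6 = D ∧ s'.ivar 8 = 6 * S ∧ ∀ k < 6, s'.ivar (30 + k) = k * S) ∧
      SectionsUpTo f D S n m (n + m) (s'.iarr 1)) ?_ ?_
  · refine Runs.count (n + m) 60 (fun x s' => s'.ivar 12 = x ∧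
      SectionsUpTo f D S n m x (s'.iarr 1)) [12, 13] [1] ?_ ?_ ?_ ?_ ?_ ?_
    · simp
    · simp [hz]
      exact ⟨fun y hy => by omega, fun y hy => by omega, fun _ _ _ => ⟨rfl, rfl⟩⟩
    · rintro x s' - fr ⟨h12, -⟩
      simp [h12, fr.ivar 5, h5]
    · rintro x s' hx fr ⟨h12, h⟩
      have e1 : s'.ivar 1 = m := by simp [fr.ivar 1, h1]
      have e6 : s'.ivar 6 = D := by simp [fr.ivar 6, h5]; omega
      have e10 : s'.ivar 10 = s.ivar 10 := by simp [fr.ivar 10]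
      have e31 : s'.ivar 31 = S := by simp [fr.ivar 31, h5, hS]
      have e32 : s'.ivar 32 = 2 * S := by simp [fr.ivar 32, h5, hS]; ring
      have e33 : s'.ivar 33 = 3 * S := by simp [fr.ivar 33, h5, hS]; ring
      have e34 : s'.ivar 34 = 4 * S := by simp [fr.ivar 34, h5, hS]; ring
      have e35 : s'.ivar 35 = 5 * S := by simp [fr.ivar 35, h5, hS]; ring
      have ea : s'.iarr 0 = s.iarr 0 := by simp [fr.iarr 0]
      have hfx : s'.iarr 0 (s.ivar 10 + x) = f x := by rw [ea, hf x hx]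
      have hfxN := hfN x hx
      have hne : ∀ y < x, f y ≠ f x := fun y hy h => by
        have := hpf y (by omega)
        rw [h, hpf x hx] at this
        omega
      refine .of_loopFree (by simp) (by simp) ?_
      have hf' : ∀ y ≤ x, f y < n + m := fun y hy => hfN y (by omega)
      by_cases hm : f x < m
      · simp [h12, e10, hfx, e1, hm, e6, e32, e33, e34]
        exact h.succ_second hS hD hx hf' hne hm fun z => by simp [setCell_apply]
      · simp [h12, e10, hfx, e1, hm, e6, e31, e35]
        exact h.succ_first hS hD hx hf' hne (not_lt.1 hm) fun z => by simp [setCell_apply]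
    · simp; omega
    · rintro s' fr ⟨-, h⟩
      refine ⟨⟨by simp [fr.ivar 0, h0], by simp [fr.ivar 1, h1], by simp [fr.ivar 5, h5],
        by simp [fr.ivar 6, h5]; omega, by simp [fr.ivar 8, h5]; omega, fun k hk => ?_⟩, h⟩
      rw [hS]
      interval_cases k
      · simp [fr.ivar 30]
      · simp [fr.ivar 31, h5]
      · simp [fr.ivar 32, h5]; ring
      · simp [fr.ivar 33, h5]; ring
      · simp [fr.ivar 34, h5]; ring
      · simp [fr.ivar 35, h5]; ring
  · rintro s' ⟨⟨e0, e1, e5, e6, e8, er⟩, h⟩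
    have r1 := er 1 (by omega)
    have r3 := er 3 (by omega)
    have r4 := er 4 (by omega)
    simp at r1 r3 r4
    refine .of_loopFree (by simp) (by simp) ?_
    simp [e0, e1, e5, r1, r3, r4, e6, e8]
    exact ⟨er, h.sections hS hD hpos hpf hfN fun z => by simp [setCell_apply]⟩

theorem sortKey_injective (key : ℕ → ℝ) : Function.Injective (sortKey key) := fun e f h => by
  have := congrArg (fun x => (ofLex x).2) h
  simpa [sortKey] using this

/-- Sort the vertices of both curves and build the search structure. -/
def prepareProg : Prog := keysProg ;; sortProg ;; sectionsProg ;; tableProg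

/-- After the preprocessing, the relation "within distance `δ`" is expressed by natural numbers,
the ranks of the vertices. -/
theorem runs_prepareProg {n m : ℕ} [NeZero n] [NeZero m] (π : Fin n → ℝ) (σ : Fin m → ℝ) (δ : ℝ)
    {r : ℕ} (hr : r = Nat.clog 2 (6 * (n + m + 1))) :
    Runs prepareProg (inputState π σ δ) (r * (800 * (n + m) + 1000) + 130 * (n + m) + 250)
      fun s => s.ivar 0 = n ∧ s.ivar 1 = m ∧ s.out = [] ∧ ∃ (K h g : ℕ → ℕ) (M D : ℕ),
        Side K M r 30 n m D h g s ∧ Side K M r 33 m n D g h s ∧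
        ∀ i j, π i - σ j ≤ δ ↔ h i + g j ≤ D := by
  have hn := NeZero.pos n
  have hm := NeZero.pos m
  have hclog : Nat.clog 2 (n + m) ≤ r := hr ▸ Nat.clog_mono_right 2 (by omega)
  refine ((runs_keysProg π σ δ).seq (T' := r * (200 * (n + m) + 200) + 50 +
    (80 * (n + m) + 100 + (r * (100 * (6 * (n + m + 1)) + 200) + 50))) ?_).mono
    (by ring_nf; omega) fun _ h => h
  rintro s ⟨⟨h0, h1, h5, hz, ho⟩, hid, hσ, hπ⟩
  refine (((runs_sortProg (by rwa [h5])).frame [10, 11, 12, 13, 14, 15, 16] [0]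
    (by simp [sortProg, mergeProg])).mono ?_ fun _ h => h).seq ?_
  · rw [h5]
    have := Nat.mul_le_mul_right (200 * (n + m) + 200) hclog
    omega
  rintro s1 ⟨fr1, w, hw, hb⟩
  rw [h5] at hb hw
  obtain ⟨pos, hpos, hpf, hle⟩ := hb.exists_pos hw (sortKey_injective _)
  have a0 := fr1.ivar 0 (by simp)
  have a1 := fr1.ivar 1 (by simp)
  have a5 := fr1.ivar 5 (by simp)
  have az := fr1.iarr 1 (by simp)
  have ao := fr1.out
  refine ((runs_sectionsProg (n := n) (m := m) (D := n + m - 1) (s := s1) (by omega) (by rw [a0, h0])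
    (by rw [a1, h1]) (by rw [a5, h5]) (by rw [az, hz]) (fun x _ => rfl) hpos hpf hb.range).frame
    [6, 30, 31, 32, 33, 34, 35, 8, 12, 13] [1] (by simp [sectionsProg])).seq ?_
  rintro s2 ⟨fr2, e6, e8, e30, secA, secB⟩
  have b0 := fr2.ivar 0 (by simp)
  have b1 := fr2.ivar 1 (by simp)
  have bo := fr2.out
  refine ((runs_tableProg s2).frame [9, 10, 11, 12, 13] [1, 2, 3]
    (by simp [tableProg, levelProg])).mono (by rw [e8, ← hr]) ?_
  rintro s3 ⟨fr3, e9, ht⟩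
  rw [e8, ← hr] at e9 ht
  have c0 := fr3.ivar 0 (by simp)
  have c1 := fr3.ivar 1 (by simp)
  have c6 := fr3.ivar 6 (by simp)
  have co := fr3.out
  have c30 : ∀ k < 6, s3.ivar (30 + k) = k * (n + m + 1) := fun k hk => by
    rw [fr3.ivar _ (by simp; omega), e30 k hk]
  have hpow : 6 * (n + m + 1) ≤ 2 ^ r := hr ▸ Nat.le_pow_clog (by norm_num) _
  refine ⟨by rw [c0, b0, a0, h0], by rw [c1, b1, a1, h1], by rw [co, bo, ao, ho], _, _, _, _, _,
    ⟨ht, e9, hpow, by rw [c6, e6], 0, n + m + 1, by simpa using c30 0, by simpa using c30 1,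
      by simpa using c30 2, secA, by omega, by omega, by omega⟩,
    ⟨ht, e9, hpow, by rw [c6, e6], 3 * (n + m + 1), n + m + 1, by simpa using c30 3,
      (c30 4 (by omega)).trans (by ring), (c30 5 (by omega)).trans (by ring), secB, by omega,
      by omega, by omega⟩, fun i j => ?_⟩
  have hi := i.2
  have hj := j.2
  have hp1 := (hpos (m + i) (by omega)).1
  have key : sortKey (s.rarr 2) j ≤ sortKey (s.rarr 2) (m + i) ↔ - σ j ≤ δ - π i := by
    rw [sortKey_le_iff, hσ, hπ]
    exact ⟨fun h => h.1, fun h => ⟨h, fun h' => by omega⟩⟩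
  rw [hle _ (by omega) _ (by omega)] at key
  constructor
  · intro h
    have := key.2 (by linarith)
    omega
  · intro h
    have := key.1 (by omega)
    linarith

/-! ### The program -/

/-- The loop of the greedy algorithm. The indices `p`, `q` are in the variables 2 and 3, and the
variable 4 tells whether the last iteration has found a greedy step. -/
def loopProg : Prog :=
  .loop (.ile (.lit 1) (.var 4))
    (.setI 4 (.lit 0) ;; stepProg 30 33 2 3 ;; stepProg 33 30 3 2 ;;
     .branch (.ile (.lit 1) (.var 4)) (.emit (.var 2) ;; .emit (.var 3)) (.skip 4))

/-- The greedy algorithm: the initial test, the preprocessing, the loop and the final test. -/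
def greedyProg : Prog :=
  .branch (.rle (.cell 0 (.lit 0) - .cell 1 (.lit 0)) (.var 0))
    (prepareProg ;; .setI 2 (.lit 0) ;; .setI 3 (.lit 0) ;; .setI 4 (.lit 1) ;;
     .emit (.var 2) ;; .emit (.var 3) ;; loopProg ;;
     .branch (.and (.ile (.var 0) (.var 2 + .lit 1)) (.ile (.var 1) (.var 3 + .lit 1)))
       (.emit (.lit 1)) (.emit (.lit 0)))
    (.emit (.lit 0))

section Loop

variable {n m : ℕ} [NeZero n] [NeZero m] {π : Fin n → ℝ} {σ : Fin m → ℝ} {δ : ℝ}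

theorem IsPartialRun.concat {L : List (Fin n × Fin m)} {x y : Fin n × Fin m}
    (hL : IsPartialRun π σ δ L) (hx : L.getLast? = some x) (h : LoopStep π σ δ x y) :
    IsPartialRun π σ δ (L ++ [y]) := by
  refine ⟨by simp [hL.1], ?_⟩
  rw [List.isChain_append]
  refine ⟨hL.2, .singleton _, ?_⟩
  simp [hx, h]

/-- The invariant of the loop; `k` bounds the number of remaining iterations. -/
def LoopInv (π : Fin n → ℝ) (σ : Fin m → ℝ) (δ : ℝ) (K h g : ℕ → ℕ) (M r D k : ℕ) (s : State) :
    Prop :=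
  Side K M r 30 n m D h g s ∧ Side K M r 33 m n D g h s ∧ s.ivar 0 = n ∧ s.ivar 1 = m ∧
    ∃ (L : List (Fin n × Fin m)) (x : Fin n × Fin m), IsPartialRun π σ δ L ∧
      L.getLast? = some x ∧ s.ivar 2 = x.1 ∧ s.ivar 3 = x.2 ∧ π x.1 - σ x.2 ≤ δ ∧
      s.out = L.flatMap (fun x => [(x.1 : ℕ), (x.2 : ℕ)]) ∧
      ((s.ivar 4 = 1 ∧ (x.1 : ℕ) + x.2 + k = n + m) ∨ (s.ivar 4 = 0 ∧ LoopEnds π σ δ x))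

/-- One iteration of the loop of `loopProg` carries out one iteration of the greedy algorithm. -/
theorem LoopInv.runs_body {K h g : ℕ → ℕ} {M r D k : ℕ} {s : State}
    (hF : ∀ i j, π i - σ j ≤ δ ↔ h i + g j ≤ D) (hI : LoopInv π σ δ K h g M r D k s)
    (hc : 1 ≤ s.ivar 4) :
    Runs (.setI 4 (.lit 0) ;; stepProg 30 33 2 3 ;; stepProg 33 30 3 2 ;;
      .branch (.ile (.lit 1) (.var 4)) (.emit (.var 2) ;; .emit (.var 3)) (.skip 4)) s
      (240 * r + 450) fun s' => ∃ k' < k, LoopInv π σ δ K h g M r D k' s' := by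
  obtain ⟨hA, hB, h0, h1, L, x, hL, hx, h2, h3, hfree, ho, h4⟩ := hI
  have hk : (x.1 : ℕ) + x.2 + k = n + m := by
    rcases h4 with h4 | h4
    · exact h4.2
    · omega
  refine .loopFree_seq (T := 240 * r + 430) (by simp) ?_ (by simp; omega)
  have fr0 : SameExcept [4] [] s (Prog.run (.setI 4 (.lit 0)) s) :=
    ⟨rfl, rfl, rfl, fun y hy => by simp at hy; simp [hy], fun _ _ => rfl⟩
  have hA0 := hA.of_sameExcept fr0 (by simp)
  have hB0 := hB.of_sameExcept fr0 (by simp)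
  obtain ⟨s0, hs0⟩ : ∃ s0, Prog.run (.setI 4 (.lit 0)) s = s0 := ⟨_, rfl⟩
  have h40 : s0.ivar 4 = 0 := by rw [← hs0]; simp
  rw [hs0] at fr0 hA0 hB0 ⊢
  refine ((runs_stepProg (by norm_num) (by norm_num) (by norm_num) (by norm_num) hA0 hB0
    (F := fun i j => π i - σ j ≤ δ) hF (P := x.1) (Q := x.2)
    ((fr0.ivar 2 (by simp)).trans h2) ((fr0.ivar 3 (by simp)).trans h3) hfree).seq
    (T' := 120 * r + 230) ?_).mono (by omega) fun _ h => h
  rintro s1 ⟨fr1, hstep1⟩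
  have hA1 := hA0.of_sameExcept fr1 (by simp)
  have hB1 := hB0.of_sameExcept fr1 (by simp)
  obtain ⟨p, hp, hup, hfree1, hgo1⟩ : ∃ p : Fin n, s1.ivar 2 = p ∧ UpdatePi π σ δ x.1 x.2 p ∧
      π p - σ x.2 ≤ δ ∧ ((s1.ivar 4 = 1 ∧ p ≠ x.1) ∨
        (s1.ivar 4 = 0 ∧ p = x.1 ∧ ∀ R, ¬ IsGreedyStepPi π σ δ x.1 x.2 R)) := by
    rcases hstep1 with ⟨p, hp1, hp2, hp3⟩ | ⟨hno, hp2, hp3⟩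
    · exact ⟨p, hp2, .inl (isGreedyStepPi_iff.2 hp1), hp1.2.1 p hp1.1 le_rfl,
        .inl ⟨hp3, hp1.1.ne'⟩⟩
    · have hno' : ∀ R, ¬ IsGreedyStepPi π σ δ x.1 x.2 R := fun R hR =>
        hno R (isGreedyStepPi_iff.1 hR)
      exact ⟨x.1, hp2, .inr ⟨rfl, hno'⟩, hfree, .inr ⟨by rw [hp3, h40], rfl, hno'⟩⟩
  refine ((runs_stepProg (by norm_num) (by norm_num) (by norm_num) (by norm_num) hB1 hA1
    (F := fun j i => π i - σ j ≤ δ) (fun j i => by rw [hF, add_comm]) (P := x.2) (Q := p)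
    (by rw [fr1.ivar 3 (by simp), fr0.ivar 3 (by simp), h3]) hp hfree1).seq
    (T' := 30) ?_).mono (by omega) fun _ h => h
  rintro s2 ⟨fr2, hstep2⟩
  have hA2 := hA1.of_sameExcept fr2 (by simp)
  have hB2 := hB1.of_sameExcept fr2 (by simp)
  obtain ⟨q, hq, huq, hfree2, hgo2⟩ : ∃ q : Fin m, s2.ivar 3 = q ∧ UpdateSigma π σ δ p x.2 q ∧
      π p - σ q ≤ δ ∧ ((s2.ivar 4 = 1 ∧ q ≠ x.2) ∨
        (s2.ivar 4 = s1.ivar 4 ∧ q = x.2 ∧ ∀ R, ¬ IsGreedyStepSigma π σ δ p x.2 R)) := by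
    rcases hstep2 with ⟨q, hq1, hq2, hq3⟩ | ⟨hno, hq2, hq3⟩
    · exact ⟨q, hq2, .inl (isGreedyStepSigma_iff.2 hq1), hq1.2.1 q hq1.1 le_rfl,
        .inl ⟨hq3, hq1.1.ne'⟩⟩
    · have hno' : ∀ R, ¬ IsGreedyStepSigma π σ δ p x.2 R := fun R hR =>
        hno R (isGreedyStepSigma_iff.1 hR)
      exact ⟨x.2, hq2, .inr ⟨rfl, hno'⟩, hfree1, .inr ⟨hq3, rfl, hno'⟩⟩
  have hp2 : s2.ivar 2 = p := by rw [fr2.ivar 2 (by simp), hp]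
  have e0 : s2.ivar 0 = n := by
    rw [fr2.ivar 0 (by simp), fr1.ivar 0 (by simp), fr0.ivar 0 (by simp), h0]
  have e1 : s2.ivar 1 = m := by
    rw [fr2.ivar 1 (by simp), fr1.ivar 1 (by simp), fr0.ivar 1 (by simp), h1]
  have eo : s2.out = L.flatMap (fun x => [(x.1 : ℕ), (x.2 : ℕ)]) := by
    rw [fr2.out, fr1.out, fr0.out, ho]
  have hfin : (s2.ivar 4 = 1 ∧ (p, q) ≠ x) ∨ (s2.ivar 4 = 0 ∧ (p, q) = x ∧ LoopEnds π σ δ x) := by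
    rcases hgo2 with ⟨h4, hne⟩ | ⟨h4, rfl, hno2⟩
    · exact .inl ⟨h4, fun h => hne (congrArg Prod.snd h)⟩
    · rcases hgo1 with ⟨h4', hne⟩ | ⟨h4', rfl, hno1⟩
      · exact .inl ⟨h4.trans h4', fun h => hne (congrArg Prod.fst h)⟩
      · exact .inr ⟨h4.trans h4', rfl, hno1, hno2⟩
  refine .of_loopFree (by simp) (by simp) ?_
  rcases hfin with ⟨h4', hne⟩ | ⟨h4', rfl, hend⟩
  · have hstep : LoopStep π σ δ x (p, q) := ⟨⟨hup, huq⟩, hne⟩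
    have hlt := hstep.add_lt
    simp only at hlt
    refine ⟨n + m - (p + q), by omega, ?_⟩
    have := p.2
    have := q.2
    simp [h4']
    refine ⟨⟨⟨hA2.table.base, hA2.table.width, hA2.table.offset, hA2.table.level⟩, hA2.levels,
      hA2.le_pow, hA2.top, hA2.secs⟩, ⟨⟨hB2.table.base, hB2.table.width, hB2.table.offset,
      hB2.table.level⟩, hB2.levels, hB2.le_pow, hB2.top, hB2.secs⟩, e0, e1, L ++ [(p, q)], (p, q),
      hL.concat hx hstep, by simp, hp2, hq, hfree2, ?_, .inl ⟨h4', by simp only; omega⟩⟩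
    simp [eo, hp2, hq]
  · have := p.2
    have := q.2
    refine ⟨0, by simp only at hk; omega, ?_⟩
    have hself : Function.update s2.ivar 4 0 = s2.ivar := by rw [← h4', Function.update_eq_self]
    simp [h4', hself]
    exact ⟨hA2, hB2, e0, e1, L, (p, q), hL, hx, hp2, hq, hfree2, eo, .inr ⟨h4', hend⟩⟩

theorem runs_greedyProg (hsep : Separated π σ) {r : ℕ} (hr : r = Nat.clog 2 (6 * (n + m + 1))) :
    Runs greedyProg (inputState π σ δ) (r * (1040 * (n + m) + 1000) + 600 * (n + m) + 400)
      fun s => ∃ (L : List (Fin n × Fin m)) (b : Bool), GreedyExecution π σ δ L b ∧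
        s.out = protocol L b := by
  have hn := NeZero.pos n
  have hm := NeZero.pos m
  have hcell : (inputState π σ δ).rarr 0 0 - (inputState π σ δ).rarr 1 0 = π 0 - σ 0 := by
    simp [inputState, hn, hm]
  have hδ : (inputState π σ δ).rvar 0 = δ := by simp [inputState]
  refine .branch (r * (1040 * (n + m) + 1000) + 600 * (n + m) + 390) (fun hc => ?_) (fun hc => ?_)
    (by simp; omega)
  · replace hc : π 0 - σ 0 ≤ δ := by simpa [hcell, hδ] using hc
    refine ((runs_prepareProg π σ δ hr).seq (T' := (n + m) * (240 * r + 460) + 100) ?_).mono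
      (by ring_nf; omega) fun _ h => h
    rintro s ⟨h0, h1, ho, K, h, g, M, D, hA, hB, hF⟩
    refine .loopFree_seq (by simp) (.loopFree_seq (by simp) (.loopFree_seq (by simp)
      (.loopFree_seq (by simp) (.loopFree_seq (by simp)
      (T := (n + m) * (240 * r + 460) + 80) ?_ le_rfl) le_rfl) le_rfl) le_rfl) (by simp; omega)
    refine (((Runs.loop (LoopInv π σ δ K h g M r D) (fun k s hI hc =>
      hI.runs_body hF (by simpa using hc)) (n + m) _ ?_).mono
      (T' := (n + m) * (240 * r + 460) + 10) (by simp; ring_nf; omega) fun _ h => h).seq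
      (T' := 20) ?_).mono (by omega) fun _ h => h
    · simp
      refine ⟨⟨⟨hA.table.base, hA.table.width, hA.table.offset, hA.table.level⟩, hA.levels,
        hA.le_pow, hA.top, hA.secs⟩, ⟨⟨hB.table.base, hB.table.width, hB.table.offset,
        hB.table.level⟩, hB.levels, hB.le_pow, hB.top, hB.secs⟩, h0, h1, [(0, 0)], (0, 0),
        ⟨rfl, .singleton _⟩, rfl, by simp, by simp, hc, by simp [ho], .inl ⟨by simp, by simp⟩⟩
    · rintro s' ⟨⟨k, hA', hB', h0', h1', L, x, hL, hx, h2, h3, hfree, ho', h4⟩, hc'⟩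
      have hend : LoopEnds π σ δ x := by
        rcases h4 with h4 | h4
        · exact absurd (by simp [h4.1]) hc'
        · exact h4.2
      refine .of_loopFree (by simp) (by simp) ⟨L, decide ((x.1 : ℕ) + 1 = n ∧ (x.2 : ℕ) + 1 = m),
        .inr ⟨(hsep.dist_le_iff 0 0).2 hc, hL, x, hx, hend, by simp⟩, ?_⟩
      have hp := x.1.2
      have hq := x.2.2
      by_cases hl : (x.1 : ℕ) + 1 = n ∧ (x.2 : ℕ) + 1 = m
      · simp [h0', h1', h2, h3, hl, ho', protocol]
      · have hl' : ¬ (n ≤ x.1 + 1 ∧ m ≤ x.2 + 1) := by omega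
        simp only [Prog.run, Test.holds_and, Test.holds_ile, IExp.eval_var, IExp.eval_add,
          IExp.eval_lit, h0', h1', h2, h3, hl', hl, if_false, protocol, ho', decide_false,
          Bool.toNat_false]
  · replace hc : ¬ π 0 - σ 0 ≤ δ := by simpa [hcell, hδ] using hc
    refine .of_loopFree (by simp) (by simp) ⟨[], false, .inl ⟨?_, rfl, rfl⟩, ?_⟩
    · exact not_le.1 fun h => hc ((hsep.dist_le_iff 0 0).1 h)
    · simp [inputState, protocol]

end Loop

/-- The number of levels of the search structure is logarithmic in the number of pairs. -/
theorem clog_le_log {n m : ℕ} (hn : 0 < n) (hm : 0 < m) :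
    (Nat.clog 2 (6 * (n + m + 1)) : ℝ) ≤ 6 / Real.log 2 * Real.log ((n : ℝ) * m + 1) := by
  have hlog2 : 0 < Real.log 2 := Real.log_pos (by norm_num)
  have hN : n + m ≤ n * m + 1 := by nlinarith
  have hN' : ((n : ℝ) + m) ≤ (n : ℝ) * m + 1 := by exact_mod_cast hN
  have hN2 : (2 : ℝ) ≤ (n : ℝ) + m := by exact_mod_cast (by omega : 2 ≤ n + m)
  have h1 : Real.log ((n : ℝ) + m) ≤ Real.log ((n : ℝ) * m + 1) :=
    Real.log_le_log (by linarith) hN'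
  have h2 : Real.log 2 ≤ Real.log ((n : ℝ) + m) := Real.log_le_log (by norm_num) hN2
  have h3 : 2 ^ (Nat.clog 2 (6 * (n + m + 1)) - 1) ≤ 16 * (n + m) := by
    have := Nat.pow_pred_clog_lt_self (b := 2) (by norm_num) (x := 6 * (n + m + 1)) (by omega)
    rw [Nat.pred_eq_sub_one] at this
    omega
  have hpos : 0 < Nat.clog 2 (6 * (n + m + 1)) := Nat.clog_pos (by norm_num) (by omega)
  obtain ⟨r, hr⟩ : ∃ r, Nat.clog 2 (6 * (n + m + 1)) = r + 1 := ⟨_, (Nat.succ_pred hpos.ne').symm⟩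
  rw [hr] at h3 ⊢
  have h4 : (2 : ℝ) ^ r ≤ 2 ^ 4 * ((n : ℝ) + m) := by
    have : (2 : ℝ) ^ (r + 1 - 1) ≤ 16 * ((n : ℝ) + m) := by exact_mod_cast h3
    rw [Nat.add_sub_cancel] at this
    linarith
  have h5 := Real.log_le_log (by positivity) h4
  rw [Real.log_pow, Real.log_mul (by norm_num) (by linarith), Real.log_pow] at h5
  rw [div_mul_eq_mul_div, le_div_iff₀ hlog2]
  push_cast at h5 ⊢
  linarith

theorem time_bound {n m r : ℕ} (hn : 0 < n) (hm : 0 < m)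
    (hr : r = Nat.clog 2 (6 * (n + m + 1))) :
    ((r * (1040 * (n + m) + 1000) + 600 * (n + m) + 400 : ℕ) : ℝ) ≤
      (18000 / Real.log 2) * ((n : ℝ) + m) * Real.log ((n : ℝ) * m + 1) := by
  have h1 := clog_le_log hn hm
  rw [← hr] at h1
  have hr1 : 1 ≤ r := hr ▸ Nat.clog_pos (by norm_num) (by omega)
  have h2 : r * (1040 * (n + m) + 1000) + 600 * (n + m) + 400 ≤ 3000 * ((n + m) * r) := by
    have : n + m ≤ (n + m) * r := Nat.le_mul_of_pos_right _ hr1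
    have : 2 * r ≤ (n + m) * r := Nat.mul_le_mul_right _ (by omega)
    ring_nf at *
    omega
  calc ((r * (1040 * (n + m) + 1000) + 600 * (n + m) + 400 : ℕ) : ℝ)
      ≤ ((3000 * ((n + m) * r) : ℕ) : ℝ) := by exact_mod_cast h2
    _ = 3000 * ((n : ℝ) + m) * r := by push_cast; ring
    _ ≤ 3000 * ((n : ℝ) + m) * (6 / Real.log 2 * Real.log ((n : ℝ) * m + 1)) := by gcongr
    _ = _ := by ring

end GreedyFrechet

theorem mainTheorem3 :
    -- For any choice of greedy steps, the greedy algorithm terminates (after fewer than `n + m`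
    -- iterations that find a greedy step) and its answer is correct.
    (∀ (n m : ℕ) [NeZero n] [NeZero m] (π : Fin n → ℝ) (σ : Fin m → ℝ) (δ : ℝ),
      Separated π σ → 0 < δ →
        (∀ L : List (Fin n × Fin m), IsPartialRun π σ δ L → L.length < n + m) ∧
        (∀ (L : List (Fin n × Fin m)) (b : Bool), GreedyExecution π σ δ L b →
          (b = true ↔ discreteFrechet π σ ≤ δ))) ∧
    -- There is one real RAM program that carries out an execution of the greedy algorithm on all
    -- inputs, and it runs in time `O((n + m) log (nm))`.
    (∃ (P : Prog) (C : ℝ),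
      ∀ (n m : ℕ) [NeZero n] [NeZero m] (π : Fin n → ℝ) (σ : Fin m → ℝ) (δ : ℝ),
        Separated π σ → 0 < δ →
          ∃ (L : List (Fin n × Fin m)) (b : Bool) (t : ℕ) (s : State),
            GreedyExecution π σ δ L b ∧
            (b = true ↔ discreteFrechet π σ ≤ δ) ∧
            Exec P (inputState π σ δ) t s ∧
            s.out = protocol L b ∧
            (t : ℝ) ≤ C * ((n : ℝ) + m) * Real.log ((n : ℝ) * m + 1)) := by
  refine ⟨fun n m _ _ π σ δ hsep _ => ⟨fun L hL => length_lt_of_isPartialRun hL,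
    fun L b h => greedyExecution_correct hsep h⟩, greedyProg, 18000 / Real.log 2,
    fun n m _ _ π σ δ hsep _ => ?_⟩
  obtain ⟨t, s, hexec, ht, L, b, hLb, hout⟩ := runs_greedyProg (δ := δ) hsep rfl
  refine ⟨L, b, t, s, hLb, greedyExecution_correct hsep hLb, hexec, hout, ?_⟩
  exact (by exact_mod_cast ht : (t : ℝ) ≤ _).trans (time_bound (NeZero.pos n) (NeZero.pos m) rfl)
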